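/- Let $d\ge 1$ and let $K$ be a number field with a fixed embedding $K\hookrightarrow\mathbb{C}$. For $\underline\alpha\in\mathbb{N}^d$ write $|\underline\alpha|=\sum_i\alpha_i$ and $\underline\alpha!=\prod_i\alpha_i!$. **Gevrey series.** For $s\in\mathbb{Q}$ let $K\{\underline x\}_s$ be the set of power series $f=\sum_{\underline\alpha\in\mathbb{N}^d}a_{\underline\alpha}\underline x^{\underline\alpha}\in K[[\underline x]]$ such that - there is a constant $C_1>0$ such that for all $\underline\alpha$ every conjugate over $\mathbb{Q}$ of the algebraic number $a_{\underline\alpha}/(\underline\alpha!)^s$ has absolute value at most $C_1^{|\underline\alpha|+1}$; - there is a constant $C_2>0$ such that for all $n\in\mathbb{N}$ there is a positive integer $D\le C_2^{n+1}$ such that $D\,a_{\underline\alpha}/(\underline\alpha!)^s$ is an algebraic integer for all $|\underline\alpha|\le n$. **Nilsson–Gevrey series.** Consider formal series $\sum_{\underline\beta}p_{\underline\beta}(\log x_1,\dots,\log x_d)\,\underline x^{\underline\beta}$ with $\underline\beta\in(\mathbb{Q}\setminus\mathbb{Z})^d$ and polynomials $p_{\underline\beta}$. Let $NGA\{\underline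 x\}_s^K$ (resp. $NGA\{1/\underline x\}_s^K$) be the $K$-vector space of all finite sums of series $f(\underline x)\,\underline x^{\underline\gamma}(\log\underline x)^{\underline k}$ (resp. $f(1/\underline x)\,\underline x^{\underline\gamma}(\log\underline x)^{\underline k}$) with $f\in K\{\underline x\}_s$, $\underline\gamma\in(\mathbb{Q}\setminus\mathbb{Z})^d$ and $\underline k\in\mathbb{N}^d$. The space $\mathbb{C}\otimes_K NGA$ is identified with a space of formal series of the same kind with complex coefficients, $z\otimes F$ being $zF$. **Standard Laplace transform.** In one variable, for $\gamma\in\mathbb{Q}\setminus\mathbb{Z}$ and $k\in\mathbb{N}$, if $\gamma>-1$ then $$\mathcal{L}(x^\gamma(\log x)^k)=\int_0^\infty e^{-xt}t^\gamma(\log t)^k\,dt=x^{-\gamma-1}\sum_{j=0}^k\binom kj\Gamma^{(j)}(\gamma+1)(-1)^{k-j}(\log x)^{k-j},$$ and if $\gamma<-1$ then $\mathcal{L}(x^\gamma(\log x)^k)=x^{n+1}\mathcal{L}(F_{\gamma,k,n})$ with $n=\lceil-\gamma-1\rceil$ and $$F_{\gamma,k,n}=\sum_{m=0}^n\frac{(-1)^m}{m!(n-m)!}\,\frac{x^{\gamma+n+1}}{m+\gamma+1}\sum_{\ell=0}^k\frac{k!(-1)^{k-\ell}}{\ell!(m+\gamma+1)^{k-\ell}}(\log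 x)^\ell .$$ In $d$ variables, $\underline{\mathcal L}\big(\underline x^{\underline\gamma}(\log\underline x)^{\underline k}\big)=\prod_{i=1}^d\mathcal{L}(x_i^{\gamma_i}(\log x_i)^{k_i})$, and $\underline{\mathcal L}$ is extended linearly, term by term, to formal series. **Proposition.** For every $s\in\mathbb{Q}$, the transform $\underline{\mathcal L}$ induces injective $K$-linear maps $$NGA\{\underline x\}_s^K\hookrightarrow\mathbb{C}\otimes_K NGA\Big\{\frac1{\underline x}\Big\}_{s+1}^K,\qquad NGA\Big\{\frac1{\underline x}\Big\}_s^K\hookrightarrow\mathbb{C}\otimes_K NGA\{\underline x\}_{s-1}^K .$$ -/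

import Mathlib

open scoped TensorProduct Nat

noncomputable section

namespace NilssonGevrey

/-! ### The ambient space of formal logarithmic series -/

/-- The multi-exponents `β ∈ (ℚ ∖ ℤ)^d`. -/
abbrev Expo (d : ℕ) : Type := {β : Fin d → ℚ // ∀ i, ∀ m : ℤ, β i ≠ m}

/-- Formal series `∑_β p_β(log x₁, …, log x_d) x^β` with `β ∈ (ℚ ∖ ℤ)^d` and `p_β` a polynomial
with coefficients in `R`: the polynomial variable `X i` stands for `log x_i`, and the family `p`
is the series. So the term `x^γ (log x)^k` is the family with `X^k` at `γ` and `0` elsewhere. -/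
abbrev LogSeries (d : ℕ) (R : Type*) [CommRing R] : Type _ :=
  Expo d → MvPolynomial (Fin d) R

/-! ### Arithmetic Gevrey series -/

section Gevrey

variable {K : Type*} [Field K] [Algebra K ℂ] {d : ℕ}

/-- The algebraic number `a_α / (α!)^s`, where `a_α` is the coefficient of `x^α` in `f`. Here
`K` is seen inside `ℂ`, and `(α!)^s` is the positive real power. -/
def normCoeff (s : ℚ) (f : MvPowerSeries (Fin d) K) (α : Fin d →₀ ℕ) : ℂ :=
  algebraMap K ℂ (MvPowerSeries.coeff α f) /
    ((((∏ i, (α i)! : ℕ) : ℝ) ^ (s : ℝ) : ℝ) : ℂ)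

/-- `f` is an arithmetic Gevrey series of order `s`: the conjugates over `ℚ` of
`a_α / (α!)^s` have at most geometric growth in `|α|`, and so has, in `n`, the common denominator
of the `a_α / (α!)^s` with `|α| ≤ n`. (`α.degree` is `|α|`.) -/
structure IsArithGevrey (s : ℚ) (f : MvPowerSeries (Fin d) K) : Prop where
  conj_le : ∃ C : ℝ, 0 < C ∧ ∀ α : Fin d →₀ ℕ,
    ∀ w ∈ (minpoly ℚ (normCoeff s f α)).rootSet ℂ, ‖w‖ ≤ C ^ (α.degree + 1)
  denom_le : ∃ C : ℝ, 0 < C ∧ ∀ n : ℕ, ∃ D : ℕ, 0 < D ∧ (D : ℝ) ≤ C ^ (n + 1) ∧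
    ∀ α : Fin d →₀ ℕ, α.degree ≤ n → IsIntegral ℤ ((D : ℂ) * normCoeff s f α)

end Gevrey

/-! ### Nilsson–Gevrey series -/

section Nilsson

variable {K : Type*} [Field K] {d : ℕ}

open Classical in
/-- The series `f(x) x^γ (log x)^k`. The index `α` with `β = γ + α` is unique if it exists. -/
def nilssonTerm (f : MvPowerSeries (Fin d) K) (γ : Expo d) (k : Fin d →₀ ℕ) : LogSeries d K :=
  fun β => if h : ∃ α : Fin d →₀ ℕ, ∀ i, β.1 i = γ.1 i + α i then
    MvPolynomial.monomial k (MvPowerSeries.coeff h.choose f) else 0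

open Classical in
/-- The series `f(1/x) x^γ (log x)^k`. The index `α` with `β = γ - α` is unique if it exists. -/
def nilssonTermInv (f : MvPowerSeries (Fin d) K) (γ : Expo d) (k : Fin d →₀ ℕ) : LogSeries d K :=
  fun β => if h : ∃ α : Fin d →₀ ℕ, ∀ i, β.1 i = γ.1 i - α i then
    MvPolynomial.monomial k (MvPowerSeries.coeff h.choose f) else 0

variable (K d) [Algebra K ℂ]

/-- `NGA{x}_s^K`: the finite sums of series `f(x) x^γ (log x)^k` with `f` arithmetic Gevrey of
order `s`, `γ ∈ (ℚ ∖ ℤ)^d`, `k ∈ ℕ^d`. -/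
def NGA (s : ℚ) : Submodule K (LogSeries d K) :=
  Submodule.span K {F | ∃ (f : MvPowerSeries (Fin d) K) (γ : Expo d) (k : Fin d →₀ ℕ),
    IsArithGevrey s f ∧ F = nilssonTerm f γ k}

/-- `NGA{1/x}_s^K`: the finite sums of series `f(1/x) x^γ (log x)^k` with `f` arithmetic Gevrey
of order `s`, `γ ∈ (ℚ ∖ ℤ)^d`, `k ∈ ℕ^d`. -/
def NGAInv (s : ℚ) : Submodule K (LogSeries d K) :=
  Submodule.span K {F | ∃ (f : MvPowerSeries (Fin d) K) (γ : Expo d) (k : Fin d →₀ ℕ),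
    IsArithGevrey s f ∧ F = nilssonTermInv f γ k}

variable {K d}

/-- Extension of the coefficients from `K` to `ℂ`. -/
def complexify : LogSeries d K →ₗ[K] LogSeries d ℂ :=
  LinearMap.pi fun β =>
    (MvPolynomial.mapAlgHom (Algebra.ofId K ℂ)).toLinearMap ∘ₗ LinearMap.proj β

/-- The series with complex coefficients represented by an element of `ℂ ⊗_K N`:
`z ⊗ F` represents `z F`. -/
def toSeries (N : Submodule K (LogSeries d K)) : ℂ ⊗[K] N →ₗ[K] LogSeries d ℂ :=
  TensorProduct.lift
    (((LinearMap.lsmul ℂ (LogSeries d ℂ)).restrictScalars₁₂ K K).compl₂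
      (complexify ∘ₗ N.subtype))

end Nilsson

/-! ### The standard Laplace transform -/

/-- For `γ > -1`, the polynomial `P` with `ℒ(x^γ (log x)^k) = x^(-γ-1) P(log x)`, where `ℒ` is the
classical Laplace transform `ℒ(h)(x) = ∫₀^∞ e^(-xt) h(t) dt`. -/
def laplacePolyPos (γ : ℝ) (k : ℕ) : Polynomial ℝ :=
  ∑ j ∈ Finset.range (k + 1),
    Polynomial.C ((k.choose j : ℝ) * iteratedDeriv j Real.Gamma (γ + 1) * (-1) ^ (k - j)) *
      Polynomial.X ^ (k - j)

/-- For every `γ ∈ ℝ ∖ ℤ`, the polynomial `P` with `ℒ(x^γ (log x)^k) = x^(-γ-1) P(log x)`.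
If `γ < -1`, then `ℒ(x^γ (log x)^k)` is by definition `x^(n+1) ℒ(F)`, where `n = ⌈-γ-1⌉` and
`F = ∑_{m ≤ n} (-1)^m / (m! (n-m)!) * x^(γ+n+1) / (m+γ+1)
  * ∑_{l ≤ k} k! (-1)^(k-l) / (l! (m+γ+1)^(k-l)) * (log x)^l`
is the `(n+1)`-fold primitive of `x^γ (log x)^k` with exponent `γ + n + 1 ≥ 0`. -/
def laplacePoly (γ : ℝ) (k : ℕ) : Polynomial ℝ :=
  if -1 < γ then laplacePolyPos γ k
  else
    let n := ⌈-γ - 1⌉₊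
    ∑ m ∈ Finset.range (n + 1),
      Polynomial.C ((-1) ^ m / ((m ! : ℝ) * ((n - m)! : ℝ)) * (1 / (m + γ + 1))) *
        ∑ l ∈ Finset.range (k + 1),
          Polynomial.C ((k ! : ℝ) * (-1) ^ (k - l) / ((l ! : ℝ) * (m + γ + 1) ^ (k - l))) *
            laplacePolyPos (γ + n + 1) l

/-- The exponent `-β - 1`. -/
def Expo.dual {d : ℕ} (β : Expo d) : Expo d :=
  ⟨fun i => -β.1 i - 1, fun i m h => β.2 i (-m - 1) (by push_cast; linarith)⟩

/-- For fixed `β`, the linear map `p ↦ q` such that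
`ℒ(p(log x₁, …, log x_d) x^β) = q(log x₁, …, log x_d) x^(-β-1)`. It is determined by
`ℒ(x^β (log x)^k) = ∏ i, ℒ_i(x_i^(β_i) (log x_i)^(k_i))`. -/
def laplaceAt {d : ℕ} (β : Expo d) : MvPolynomial (Fin d) ℂ →ₗ[ℂ] MvPolynomial (Fin d) ℂ :=
  (MvPolynomial.basisMonomials (Fin d) ℂ).constr ℂ fun k : Fin d →₀ ℕ =>
    ∏ i, Polynomial.aeval (MvPolynomial.X i : MvPolynomial (Fin d) ℂ)
      (laplacePoly (β.1 i : ℝ) (k i))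

/-- The standard Laplace transform in several variables, applied term by term: the coefficient of
`x^β` in `ℒ(F)` comes from the coefficient of `x^(-β-1)` in `F`. -/
def laplace {d : ℕ} : LogSeries d ℂ →ₗ[ℂ] LogSeries d ℂ :=
  LinearMap.pi fun β => laplaceAt β.dual ∘ₗ LinearMap.proj β.dual

end NilssonGevrey

end

noncomputable section

namespace NilssonGevrey

/-! For every non-integer `γ`, the polynomial attached to `x^γ (log x)^k` has the numbers `Γ^(j)(γ +
1)` as coefficients, up to signs and binomials; the formula for `γ > -1` persists below `-1`
(`laplacePoly_eq`). So everything depends on how `Γ^(j)(z ± n)` varies with `n`, where `z = γ + 1`.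

The functional equation gives `Γ(t + n) = t(t + 1)⋯(t + n - 1) Γ(t)` and `Γ(t - n) = Γ(t) / ((t -
1)⋯(t - n))`. By Leibniz, `Γ^(j)(z ± n)` is a combination of the constants `Γ^(i)(z)`, `i ≤ j`,
which do not depend on `n`, with coefficients the derivatives at `z` of these rational functions.
Such derivatives are `n!^(±1)` times rational sequences of type `ArithGeom`
(`exists_iteratedDeriv_prod_add`, `exists_iteratedDeriv_inv_prod_sub`): logarithmic differentiation
reduces them to the functions themselves and to sums of powers of `1 / (z + m)`, whose denominators
divide a power of an lcm of size `exp(O(n))` by Chebyshev.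

The factor `n!^(±1)` shifts the Gevrey order by `±1`, the `ArithGeom` factor preserves both Gevrey
conditions (`IsArithGevrey.mulCoeff`), and the constants `Γ^(i)(z)` are the scalars of `ℂ ⊗ NGA`.

Injectivity is triangularity: at a fixed exponent, the transform sends `(log x)^k` to a polynomial
of degree `k` with leading coefficient `±Γ(γ + 1) ≠ 0` in each variable (`laplaceAt_injective`). -/

/-! ### Rational sequences of geometric size with geometric common denominators -/

/-- The sequence `v` grows at most geometrically, and so do the common denominators of
`v 0, …, v n`. -/
def ArithGeom (v : ℕ → ℚ) : Prop :=
  ∃ C : ℝ, 1 ≤ C ∧ ∀ n, |(v n : ℝ)| ≤ C ^ (n + 1) ∧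
    ∃ D : ℕ, 0 < D ∧ (D : ℝ) ≤ C ^ (n + 1) ∧ ∀ m ≤ n, ∃ z : ℤ, (D : ℚ) * v m = z

lemma mul_pow_le_mul_pow_succ {A B : ℝ} (hA : 1 ≤ A) (hB : 1 ≤ B) (n : ℕ) :
    A * B ^ n ≤ (A * B) ^ (n + 1) := by
  rw [mul_pow]
  have h1 : A ≤ A ^ (n + 1) := le_self_pow₀ hA (by omega)
  have h2 : B ^ n ≤ B ^ (n + 1) := pow_le_pow_right₀ hB (by omega)
  gcongr

lemma ArithGeom.of_bounds {v : ℕ → ℚ} {A B A' B' : ℝ} (hA : 1 ≤ A) (hB : 1 ≤ B)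
    (hA' : 1 ≤ A') (hB' : 1 ≤ B') (hv : ∀ n, |(v n : ℝ)| ≤ A * B ^ n)
    (hD : ∀ n, ∃ D : ℕ, 0 < D ∧ (D : ℝ) ≤ A' * B' ^ n ∧ ∀ m ≤ n, ∃ z : ℤ, (D : ℚ) * v m = z) :
    ArithGeom v := by
  refine ⟨max (A * B) (A' * B'), le_max_of_le_left (one_le_mul_of_one_le_of_one_le hA hB),
    fun n => ⟨?_, ?_⟩⟩
  · refine (hv n).trans ((mul_pow_le_mul_pow_succ hA hB n).trans ?_)
    exact pow_le_pow_left₀ (by positivity) (le_max_left _ _) _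
  · obtain ⟨D, h0, h1, h2⟩ := hD n
    refine ⟨D, h0, h1.trans ((mul_pow_le_mul_pow_succ hA' hB' n).trans ?_), h2⟩
    exact pow_le_pow_left₀ (by positivity) (le_max_right _ _) _

lemma ArithGeom.const (c : ℚ) : ArithGeom fun _ => c := by
  refine .of_bounds (A := 1 + |(c : ℝ)|) (B := 1) (A' := c.den) (B' := 1)
    (by linarith [abs_nonneg (c : ℝ)]) le_rfl (by exact_mod_cast c.pos) le_rfl (fun n => ?_)
    (fun n => ⟨c.den, c.pos, by simp, fun _ _ => ⟨c.num, Rat.den_mul_eq_num c⟩⟩)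
  simp

lemma ArithGeom.mul {u v : ℕ → ℚ} (hu : ArithGeom u) (hv : ArithGeom v) :
    ArithGeom fun n => u n * v n := by
  obtain ⟨C, hC, hu⟩ := hu
  obtain ⟨C', hC', hv⟩ := hv
  refine ⟨C * C', one_le_mul_of_one_le_of_one_le hC hC', fun n => ?_⟩
  obtain ⟨h1, D, hD, h2, h3⟩ := hu n
  obtain ⟨h1', D', hD', h2', h3'⟩ := hv n
  refine ⟨?_, D * D', Nat.mul_pos hD hD', ?_, fun m hm => ?_⟩
  · rw [mul_pow]; push_cast; rw [abs_mul]; gcongr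
  · rw [mul_pow]; push_cast; gcongr
  · obtain ⟨z, hz⟩ := h3 m hm
    obtain ⟨z', hz'⟩ := h3' m hm
    refine ⟨z * z', ?_⟩
    push_cast
    rw [← hz, ← hz']
    ring

lemma ArithGeom.add {u v : ℕ → ℚ} (hu : ArithGeom u) (hv : ArithGeom v) :
    ArithGeom fun n => u n + v n := by
  obtain ⟨C, hC, hu⟩ := hu
  obtain ⟨C', hC', hv⟩ := hv
  -- Sizes add while denominators multiply, so the constant has to dominate both `C + C'` and `C *
  -- C'`.
  refine ⟨C + C' + C * C', by nlinarith, fun n => ?_⟩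
  obtain ⟨h1, D, hD, h2, h3⟩ := hu n
  obtain ⟨h1', D', hD', h2', h3'⟩ := hv n
  have hp : 0 ≤ C * C' := by positivity
  refine ⟨?_, D * D', Nat.mul_pos hD hD', ?_, fun m hm => ?_⟩
  · push_cast
    calc |(u n : ℝ) + v n| ≤ |(u n : ℝ)| + |(v n : ℝ)| := abs_add_le _ _
      _ ≤ C ^ (n + 1) + C' ^ (n + 1) := add_le_add h1 h1'
      _ ≤ (C + C') ^ (n + 1) := pow_add_pow_le (by linarith) (by linarith) (by omega)
      _ ≤ _ := pow_le_pow_left₀ (by linarith) (by linarith) _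
  · push_cast
    calc (D : ℝ) * D' ≤ C ^ (n + 1) * C' ^ (n + 1) := by gcongr
      _ = (C * C') ^ (n + 1) := (mul_pow _ _ _).symm
      _ ≤ _ := pow_le_pow_left₀ hp (by linarith) _
  · obtain ⟨z, hz⟩ := h3 m hm
    obtain ⟨z', hz'⟩ := h3' m hm
    refine ⟨D' * z + D * z', ?_⟩
    push_cast
    rw [← hz, ← hz']
    ring

lemma ArithGeom.sum {ι : Type*} (s : Finset ι) {u : ι → ℕ → ℚ} (hu : ∀ i ∈ s, ArithGeom (u i)) :
    ArithGeom fun n => ∑ i ∈ s, u i n := by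
  classical
  induction s using Finset.induction_on with
  | empty => simpa using ArithGeom.const 0
  | insert i s hi ih =>
    simp only [Finset.sum_insert hi]
    exact (hu i (by simp)).add (ih fun j hj => hu j (by simp [hj]))

lemma arithGeom_const_pow (c : ℤ) : ArithGeom fun n => (c : ℚ) ^ n := by
  refine .of_bounds (A := 1) (B := 1 + |(c : ℝ)|) (A' := 1) (B' := 1) le_rfl
    (by linarith [abs_nonneg (c : ℝ)]) le_rfl le_rfl (fun n => ?_)
    (fun n => ⟨1, one_pos, by simp, fun m _ => ⟨c ^ m, by simp⟩⟩)
  push_cast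
  rw [abs_pow, one_mul]
  exact pow_le_pow_left₀ (abs_nonneg _) (by linarith) _

/-! ### Denominators of arithmetic progressions -/

lemma add_natCast_ne_zero {z : ℚ} (hz : ∀ m : ℤ, z ≠ m) (m : ℕ) : z + m ≠ 0 := fun h =>
  hz (-m) (by push_cast; linarith)

lemma add_natCast_eq (z : ℚ) (m : ℕ) :
    z + m = ((z.num + z.den * m : ℤ) : ℚ) / z.den := by
  have : (z.den : ℚ) ≠ 0 := by exact_mod_cast z.den_nz
  field_simp
  push_cast
  rw [add_mul, Rat.mul_den_eq_num]
  ring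

lemma num_add_ne_zero {z : ℚ} (hz : ∀ m : ℤ, z ≠ m) (m : ℕ) : z.num + z.den * m ≠ 0 := fun h => by
  have := add_natCast_eq z m
  rw [h] at this
  exact add_natCast_ne_zero hz m (by simpa using this)

lemma abs_inv_add_natCast_le {z : ℚ} (hz : ∀ m : ℤ, z ≠ m) (m : ℕ) :
    |((z + m)⁻¹ : ℚ)| ≤ z.den := by
  rw [add_natCast_eq, inv_div, abs_div]
  have h1 : (1 : ℚ) ≤ |((z.num + z.den * m : ℤ) : ℚ)| := by
    exact_mod_cast Int.one_le_abs (num_add_ne_zero hz m)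
  rw [Nat.abs_cast]
  exact div_le_self (by positivity) h1

/-- A common denominator of `1 / (z + m)` for `m ≤ n`. -/
def progDenom (z : ℚ) (n : ℕ) : ℕ := Nat.lcmUpto (z.num.natAbs + z.den * n)

lemma progDenom_pos (z : ℚ) (n : ℕ) : 0 < progDenom z n := Nat.lcmUpto_pos _

/-- The numerator of `z + m` is a nonzero integer of absolute value at most `|z.num| + z.den * n`,
hence one of the integers whose lcm is taken. -/
lemma progDenom_mul_inv {z : ℚ} (hz : ∀ m : ℤ, z ≠ m) {m n : ℕ} (hmn : m ≤ n) :
    ∃ k : ℤ, (progDenom z n : ℚ) * (z + m)⁻¹ = k := by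
  have h0 := num_add_ne_zero hz m
  have hdvd : (z.num + z.den * m).natAbs ∣ progDenom z n := by
    refine Finset.dvd_lcm (f := id) (Finset.mem_Icc.2 ⟨Int.natAbs_pos.2 h0, ?_⟩)
    refine (Int.natAbs_add_le _ _).trans ?_
    rw [Int.natAbs_mul]
    simp only [Int.natAbs_natCast]
    gcongr
  obtain ⟨k, hk⟩ := Int.natAbs_dvd.1 (Int.natCast_dvd_natCast.2 hdvd)
  refine ⟨k * z.den, ?_⟩
  have h0' : ((z.num + z.den * m : ℤ) : ℚ) ≠ 0 := by exact_mod_cast h0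
  rw [add_natCast_eq, inv_div, ← Int.cast_natCast (progDenom z n), hk, Int.cast_mul]
  field_simp
  push_cast
  ring

/-- The logarithm of `lcm(1, …, N)` is the Chebyshev function `ψ(N)`, which is `O(N)`. -/
lemma exists_progDenom_le (z : ℚ) :
    ∃ A B : ℝ, 1 ≤ A ∧ 1 ≤ B ∧ ∀ n, (progDenom z n : ℝ) ≤ A * B ^ n := by
  have hc : 0 ≤ Real.log 4 + 4 := by positivity
  refine ⟨Real.exp ((Real.log 4 + 4) * z.num.natAbs), Real.exp ((Real.log 4 + 4) * z.den),
    Real.one_le_exp (by positivity), Real.one_le_exp (by positivity), fun n => ?_⟩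
  rw [← Real.exp_nat_mul, ← Real.exp_add,
    ← Real.log_le_iff_le_exp (by exact_mod_cast progDenom_pos z n), progDenom,
    ← Chebyshev.psi_eq_log_lcmUpto]
  refine (Chebyshev.psi_le_const_mul_self (by positivity)).trans (le_of_eq ?_)
  push_cast
  ring

lemma natCast_le_two_pow (n : ℕ) : (n : ℝ) ≤ 2 ^ n := by exact_mod_cast (Nat.lt_two_pow_self).le

/-- Up to a constant factor, these sums are the derivatives of the logarithmic derivative of `t(t +
1)⋯(t + n - 1)`. -/
lemma arithGeom_sum_inv_pow {z : ℚ} (hz : ∀ m : ℤ, z ≠ m) (r : ℕ) :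
    ArithGeom fun n => ∑ m ∈ Finset.range n, ((z + m) ^ r)⁻¹ := by
  obtain ⟨A, B, hA, hB, hAB⟩ := exists_progDenom_le z
  have hq : (1 : ℝ) ≤ z.den := by exact_mod_cast z.pos
  refine .of_bounds (A := (z.den : ℝ) ^ r) (B := 2) (A' := A ^ r) (B' := B ^ r)
    (one_le_pow₀ hq) one_le_two (one_le_pow₀ hA) (one_le_pow₀ hB) (fun n => ?_)
    (fun n => ⟨progDenom z n ^ r, pow_pos (progDenom_pos z n) r, ?_, fun m hm => ?_⟩)
  · have : |∑ m ∈ Finset.range n, ((z + m) ^ r)⁻¹| ≤ n * (z.den : ℚ) ^ r := by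
      refine (Finset.abs_sum_le_sum_abs _ _).trans ?_
      refine (Finset.sum_le_card_nsmul _ _ ((z.den : ℚ) ^ r) fun m _ => ?_).trans (by simp)
      rw [← inv_pow, abs_pow]
      exact pow_le_pow_left₀ (abs_nonneg _) (abs_inv_add_natCast_le hz m) r
    have h2 : |((∑ m ∈ Finset.range n, ((z + m) ^ r)⁻¹ : ℚ) : ℝ)| ≤ n * (z.den : ℝ) ^ r := by
      exact_mod_cast this
    refine h2.trans ?_
    rw [mul_comm]
    have := natCast_le_two_pow n
    gcongr
  · push_cast
    rw [← pow_mul, mul_comm r n, pow_mul, ← mul_pow]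
    exact pow_le_pow_left₀ (by positivity) (hAB n) r
  · choose! k hk using fun m (hm : m ≤ n) => progDenom_mul_inv hz hm
    refine ⟨∑ i ∈ Finset.range m, k i ^ r, ?_⟩
    push_cast
    rw [Finset.mul_sum]
    refine Finset.sum_congr rfl fun i hi => ?_
    rw [← hk i (by have := Finset.mem_range.1 hi; omega), mul_pow, inv_pow]

/-! ### Rising factorials -/

/-- Partial fraction expansion of `n! / (z (z + 1) ⋯ (z + n))`. -/
lemma sum_choose_div_add {F : Type*} [Field F] (n : ℕ) (z : F) (hz : ∀ m : ℕ, z + m ≠ 0) :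
    ∑ m ∈ Finset.range (n + 1), (-1) ^ m * (n.choose m : F) * (z + m)⁻¹ =
      (n ! : F) * (∏ m ∈ Finset.range (n + 1), (z + m))⁻¹ := by
  induction n generalizing z with
  | zero => simp
  | succ n ih =>
    have hz' : ∀ m : ℕ, z + 1 + m ≠ 0 := fun m => by
      have := hz (m + 1)
      push_cast at this
      rwa [add_assoc, add_comm (1 : F)]
    -- Pascal's rule: the sum `S` satisfies `S_(n+1)(z) = S_n(z) - S_n(z + 1)`.
    have key : ∑ m ∈ Finset.range (n + 1 + 1), (-1) ^ m * ((n + 1).choose m : F) * (z + m)⁻¹ =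
        ∑ m ∈ Finset.range (n + 1), (-1) ^ m * (n.choose m : F) * (z + m)⁻¹ -
          ∑ m ∈ Finset.range (n + 1), (-1) ^ m * (n.choose m : F) * (z + 1 + m)⁻¹ := by
      have e : ∑ m ∈ Finset.range (n + 1), (-1) ^ m * (n.choose m : F) * (z + m)⁻¹ =
          ∑ m ∈ Finset.range (n + 1),
            (-1) ^ (m + 1) * (n.choose (m + 1) : F) * (z + (m + 1 : ℕ))⁻¹ + z⁻¹ := by
        have := Finset.sum_range_succ'
          (fun m => (-1) ^ m * (n.choose m : F) * (z + m)⁻¹) (n + 1)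
        rw [Finset.sum_range_succ] at this
        simpa [Nat.choose_succ_self] using this
      rw [Finset.sum_range_succ', e]
      simp only [Nat.choose_succ_succ', pow_zero, Nat.choose_zero_right, Nat.cast_one,
        Nat.cast_zero, add_zero, one_mul]
      rw [add_sub_right_comm, ← Finset.sum_sub_distrib]
      congr 1
      refine Finset.sum_congr rfl fun m _ => ?_
      push_cast
      rw [show z + 1 + (m : F) = z + (m + 1) by ring]
      ring
    rw [key, ih z hz, ih (z + 1) hz']
    have hP : ∏ m ∈ Finset.range (n + 1), (z + 1 + m) ≠ 0 :=
      Finset.prod_ne_zero_iff.2 fun m _ => hz' m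
    have e1 : ∏ m ∈ Finset.range (n + 1 + 1), (z + m) =
        (∏ m ∈ Finset.range (n + 1), (z + 1 + m)) * z := by
      rw [Finset.prod_range_succ']
      simp only [Nat.cast_zero, add_zero]
      congr 1
      exact Finset.prod_congr rfl fun m _ => by push_cast; ring
    have e2 : ∏ m ∈ Finset.range (n + 1 + 1), (z + m) =
        (∏ m ∈ Finset.range (n + 1), (z + m)) * (z + (n + 1 : ℕ)) := Finset.prod_range_succ _ _
    have hQ : ∏ m ∈ Finset.range (n + 1), (z + m) ≠ 0 :=
      Finset.prod_ne_zero_iff.2 fun m _ => hz m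
    have hR : ∏ m ∈ Finset.range (n + 1 + 1), (z + m) ≠ 0 :=
      Finset.prod_ne_zero_iff.2 fun m _ => hz m
    have i1 : (∏ m ∈ Finset.range (n + 1), (z + m))⁻¹ =
        (z + (n + 1 : ℕ)) * (∏ m ∈ Finset.range (n + 1 + 1), (z + m))⁻¹ := by
      rw [e2] at hR ⊢
      have := hz (n + 1)
      field_simp
    have i2 : (∏ m ∈ Finset.range (n + 1), (z + 1 + m))⁻¹ =
        z * (∏ m ∈ Finset.range (n + 1 + 1), (z + m))⁻¹ := by
      have := hz 0
      rw [Nat.cast_zero, add_zero] at this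
      rw [e1]
      field_simp
    rw [i1, i2, Nat.factorial_succ]
    push_cast
    ring

/-- A product of the denominators of all the `1 / (z + m)` would be of factorial size. Partial
fractions leave an integral combination of the `1 / (z + m)`, for which the lcm suffices. -/
lemma arithGeom_factorial_mul_inv_prod {z : ℚ} (hz : ∀ m : ℤ, z ≠ m) :
    ArithGeom fun n => (n ! : ℚ) * (∏ m ∈ Finset.range n, (z + m))⁻¹ := by
  obtain ⟨A, B, hA, hB, hAB⟩ := exists_progDenom_le z
  have hq : (1 : ℝ) ≤ z.den := by exact_mod_cast z.pos
  have hexp : ∀ n : ℕ, ((n + 1)! : ℚ) * (∏ m ∈ Finset.range (n + 1), (z + m))⁻¹ =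
      (n + 1) * ∑ m ∈ Finset.range (n + 1), (-1) ^ m * (n.choose m : ℚ) * (z + m)⁻¹ := fun n => by
    rw [sum_choose_div_add n z (add_natCast_ne_zero hz), Nat.factorial_succ]
    push_cast
    ring
  -- The base `4` is `2 * 2`: one factor bounds the binomial sum, the other bounds `n + 1`.
  refine .of_bounds (A := z.den) (B := 4) (A' := A) (B' := B) hq (by norm_num) hA hB
    (fun n => ?_) (fun n => ⟨progDenom z n, progDenom_pos z n, hAB n, fun m hm => ?_⟩)
  · rcases n with _ | n
    · simpa using hq
    · have : |((n + 1)! : ℚ) * (∏ m ∈ Finset.range (n + 1), (z + m))⁻¹| ≤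
          (n + 1 : ℕ) * (2 ^ n * z.den) := by
        rw [hexp, abs_mul]
        push_cast
        rw [abs_of_nonneg (by positivity : (0 : ℚ) ≤ n + 1)]
        gcongr
        refine (Finset.abs_sum_le_sum_abs _ _).trans ?_
        have h2 : (2 : ℚ) ^ n = ∑ m ∈ Finset.range (n + 1), (n.choose m : ℚ) := by
          exact_mod_cast (Nat.sum_range_choose n).symm
        rw [h2, Finset.sum_mul]
        refine Finset.sum_le_sum fun m _ => ?_
        rw [abs_mul, abs_mul, abs_pow, abs_neg, abs_one, one_pow, one_mul, Nat.abs_cast]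
        gcongr
        exact abs_inv_add_natCast_le hz m
      have h2 : |(((n + 1)! * (∏ m ∈ Finset.range (n + 1), (z + m))⁻¹ : ℚ) : ℝ)| ≤
          (n + 1 : ℕ) * (2 ^ n * z.den) := by exact_mod_cast this
      refine h2.trans ?_
      have h3 := natCast_le_two_pow (n + 1)
      calc ((n + 1 : ℕ) : ℝ) * (2 ^ n * z.den) ≤ 2 ^ (n + 1) * (2 ^ (n + 1) * z.den) := by
            gcongr <;> norm_num
        _ = z.den * 4 ^ (n + 1) := by
            rw [show (4 : ℝ) = 2 * 2 by norm_num, mul_pow]; ring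
  · rcases m with _ | m
    · exact ⟨progDenom z n, by simp⟩
    · choose! k hk using fun m (hm : m ≤ n) => progDenom_mul_inv hz hm
      refine ⟨(m + 1) * ∑ i ∈ Finset.range (m + 1), (-1) ^ i * m.choose i * k i, ?_⟩
      rw [hexp]
      push_cast
      rw [mul_left_comm, Finset.mul_sum]
      congr 1
      refine Finset.sum_congr rfl fun i hi => ?_
      rw [← hk i (by have := Finset.mem_range.1 hi; omega)]
      ring

lemma factorial_dvd_prod_add (n : ℕ) (c : ℕ) : n ! ∣ ∏ m ∈ Finset.range n, (c + m) := by
  rw [← Nat.ascFactorial_eq_prod_range]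
  exact Nat.factorial_dvd_ascFactorial c n

/-- Checked at each prime power `p^k` dividing `n!`. If `p ∣ q`, the factor `q^n` suffices.
Otherwise `q` is invertible modulo `p^k`, and the progression becomes `q` times a run of `n`
consecutive integers, whose product is divisible by `n!`. -/
lemma factorial_dvd_pow_mul_prod (a : ℤ) (q n : ℕ) :
    ((n ! : ℕ) : ℤ) ∣ q ^ n * ∏ m ∈ Finset.range n, (a + q * m) := by
  rw [Int.natCast_dvd, Nat.dvd_iff_prime_pow_dvd_dvd]
  intro p k hp hk
  rw [← Int.natCast_dvd]
  by_cases hpq : p ∣ q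
  · refine dvd_mul_of_dvd_left ?_ _
    have : Fact p.Prime := ⟨hp⟩
    have hkn : k ≤ n := by
      rcases eq_or_ne n 0 with rfl | hn
      · have h : p = 1 ∨ k = 0 := by simpa using hk
        exact (h.resolve_left hp.one_lt.ne').le
      · exact ((padicValNat_dvd_iff_le n.factorial_ne_zero).1 hk).trans
          (padicValNat_factorial_lt_of_ne_zero p hn).le
    exact_mod_cast (pow_dvd_pow p hkn).trans (pow_dvd_pow_of_dvd hpq n)
  · refine dvd_mul_of_dvd_right ?_ _
    have hcop : (q.gcd (p ^ k)) = 1 :=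
      (Nat.Coprime.pow_right k ((Nat.Prime.coprime_iff_not_dvd hp).2 hpq).symm)
    have hpk : 0 < p ^ k := pow_pos hp.pos k
    have hbez : (q : ZMod (p ^ k)) * (q : ZMod (p ^ k))⁻¹ = 1 :=
      ZMod.coe_mul_inv_eq_one q hcop
    have : NeZero (p ^ k) := ⟨hpk.ne'⟩
    set c : ZMod (p ^ k) := a * (q : ZMod (p ^ k))⁻¹ with hc
    have hfac : ((∏ m ∈ Finset.range n, (c.val + m) : ℕ) : ZMod (p ^ k)) = 0 := by
      rw [ZMod.natCast_eq_zero_iff]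
      exact hk.trans (factorial_dvd_prod_add n _)
    rw [← ZMod.intCast_zmod_eq_zero_iff_dvd]
    push_cast at hfac ⊢
    simp only [ZMod.natCast_val, ZMod.cast_id', id_eq] at hfac
    have : ∀ m : ℕ, (a : ZMod (p ^ k)) + q * m = q * (c + m) := fun m => by
      rw [hc]
      linear_combination (-(a : ZMod (p ^ k))) * hbez
    simp only [this, Finset.prod_mul_distrib, hfac, mul_zero]

/-- One factor `z.den ^ n` clears the fractions `z + m`, a second one compensates the division by
`n!`. The size is geometric because each `(z + m) / (m + 1)` is at most `|z| + 1` in absolute value.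
-/
lemma arithGeom_prod_div_factorial (z : ℚ) :
    ArithGeom fun n => (∏ m ∈ Finset.range n, (z + m)) * (n ! : ℚ)⁻¹ := by
  have hq : (1 : ℝ) ≤ z.den := by exact_mod_cast z.pos
  have hq0 : (z.den : ℚ) ≠ 0 := by exact_mod_cast z.den_nz
  refine .of_bounds (A := 1) (B := |(z : ℝ)| + 1) (A' := 1) (B' := z.den ^ 2) le_rfl
    (by linarith [abs_nonneg (z : ℝ)]) le_rfl (one_le_pow₀ hq) (fun n => ?_)
    (fun n => ⟨(z.den ^ 2) ^ n, by have := z.pos; positivity, by simp, fun m hm => ?_⟩)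
  · have : |(∏ m ∈ Finset.range n, (z + m)) * (n ! : ℚ)⁻¹| ≤ 1 * (|z| + 1) ^ n := by
      rw [one_mul]
      induction n with
      | zero => simp
      | succ n ih =>
        rw [Finset.prod_range_succ, Nat.factorial_succ, pow_succ]
        rw [show (∏ m ∈ Finset.range n, (z + m)) * (z + n) * (((n + 1) * n ! : ℕ) : ℚ)⁻¹ =
          ((∏ m ∈ Finset.range n, (z + m)) * (n ! : ℚ)⁻¹) * ((z + n) / (n + 1)) by
            push_cast
            rw [mul_inv]
            ring, abs_mul]
        gcongr
        rw [abs_div, abs_of_pos (by positivity : (0 : ℚ) < n + 1), div_le_iff₀ (by positivity)]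
        have h1 := abs_add_le z n
        rw [Nat.abs_cast] at h1
        nlinarith [abs_nonneg z, mul_nonneg (abs_nonneg z) (Nat.cast_nonneg (α := ℚ) n)]
    exact_mod_cast this
  · obtain ⟨k, hk⟩ := factorial_dvd_pow_mul_prod z.num z.den m
    refine ⟨(z.den ^ 2) ^ (n - m) * k, ?_⟩
    have hk' : (z.den : ℚ) ^ m * ∏ i ∈ Finset.range m, ((z.num : ℚ) + z.den * i) =
      (m ! : ℚ) * k := by exact_mod_cast hk
    have hP : (z.den : ℚ) ^ m * ∏ i ∈ Finset.range m, (z + i) =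
        ∏ i ∈ Finset.range m, ((z.num : ℚ) + z.den * i) := by
      nth_rewrite 1 [← Finset.card_range m]
      rw [← Finset.prod_const, ← Finset.prod_mul_distrib]
      refine Finset.prod_congr rfl fun i _ => ?_
      rw [mul_add, Rat.den_mul_eq_num]
    have hf : (m ! : ℚ) ≠ 0 := by exact_mod_cast m.factorial_ne_zero
    obtain ⟨t, rfl⟩ := Nat.exists_eq_add_of_le hm
    rw [Nat.add_sub_cancel_left]
    push_cast
    rw [← hP] at hk'
    rw [pow_add, mul_comm (((z.den : ℚ) ^ 2) ^ m), mul_assoc]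
    congr 1
    rw [← mul_assoc, ← div_eq_mul_inv, div_eq_iff hf, ← pow_mul, mul_comm 2 m, mul_comm (k : ℚ), ← hk']
    ring

/-! ### Derivatives of the Gamma function at shifted arguments -/

open Filter Topology ContDiff

lemma eventually_ne_intCast {z : ℝ} (hz : ∀ m : ℤ, z ≠ m) : ∀ᶠ t : ℝ in 𝓝 z, ∀ m : ℤ, t ≠ m := by
  have h := Int.isClosedEmbedding_coe_real.isClosed_range.isOpen_compl.mem_nhds
    (show z ∈ (Set.range ((↑) : ℤ → ℝ))ᶜ from fun ⟨m, hm⟩ => hz m hm.symm)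
  filter_upwards [h] with t ht m hm
  exact ht ⟨m, hm.symm⟩

/-- `1 / Γ` is entire and does not vanish away from the poles of `Γ`. -/
lemma contDiffAt_Gamma {z : ℝ} (hz : ∀ m : ℤ, z ≠ m) {n : WithTop ℕ∞} :
    ContDiffAt ℝ n Real.Gamma z := by
  have h0 : Complex.Gamma z ≠ 0 := Complex.Gamma_ne_zero fun m h =>
    hz (-m) (by push_cast; exact_mod_cast h)
  have h1 : ContDiffAt ℂ n (fun s => (Complex.Gamma s)⁻¹) z :=
    (Complex.differentiable_one_div_Gamma.analyticAt _).contDiffAt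
  have h2 : ContDiffAt ℂ n Complex.Gamma z :=
    (h1.inv (inv_ne_zero h0)).congr_of_eventuallyEq (.of_forall fun s => (inv_inv _).symm)
  exact h2.real_of_complex

lemma ne_intCast_add_natCast {z : ℝ} (hz : ∀ m : ℤ, z ≠ m) (n : ℕ) : ∀ m : ℤ, z + n ≠ m :=
  fun m h => hz (m - n) (by push_cast; linarith)

lemma ne_intCast_sub_natCast {z : ℝ} (hz : ∀ m : ℤ, z ≠ m) (n : ℕ) : ∀ m : ℤ, z - n ≠ m :=
  fun m h => hz (m + n) (by push_cast; linarith)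

lemma ne_zero_of_ne_intCast {z : ℝ} (hz : ∀ m : ℤ, z ≠ m) : z ≠ 0 := by simpa using hz 0

lemma Gamma_add_natCast {t : ℝ} (ht : ∀ m : ℤ, t ≠ m) (n : ℕ) :
    Real.Gamma (t + n) = (∏ m ∈ Finset.range n, (t + m)) * Real.Gamma t := by
  induction n with
  | zero => simp
  | succ n ih =>
    rw [Nat.cast_succ, ← add_assoc,
      Real.Gamma_add_one (ne_zero_of_ne_intCast (ne_intCast_add_natCast ht n)), ih,
      Finset.prod_range_succ]
    ring

lemma Gamma_sub_natCast {t : ℝ} (ht : ∀ m : ℤ, t ≠ m) (n : ℕ) :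
    Real.Gamma (t - n) = (∏ m ∈ Finset.range n, (t + (-1 - m)))⁻¹ * Real.Gamma t := by
  induction n with
  | zero => simp
  | succ n ih =>
    have h0 := ne_zero_of_ne_intCast (ne_intCast_sub_natCast ht (n + 1))
    have h := Real.Gamma_add_one h0
    rw [show t - (n + 1 : ℕ) + 1 = t - n by push_cast; ring, ih] at h
    rw [Finset.prod_range_succ, mul_inv, mul_right_comm, h,
      show t + (-1 - (n : ℝ)) = t - (n + 1 : ℕ) by push_cast; ring]
    field_simp

lemma iteratedDeriv_add_const_inv (r : ℕ) (c z : ℝ) :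
    iteratedDeriv r (fun t => (t + c)⁻¹) z = (-1) ^ r * r ! * ((z + c) ^ (r + 1))⁻¹ := by
  have := congrFun (iter_deriv_inv_linear r (1 : ℝ) c) z
  simp only [one_mul, one_pow, mul_one] at this
  rw [iteratedDeriv_eq_iterate, this, show (-1 - r : ℤ) = -((r + 1 : ℕ) : ℤ) by push_cast; ring,
    zpow_neg, zpow_natCast]

lemma contDiffAt_add_const_inv {z c : ℝ} (h : z + c ≠ 0) {n : WithTop ℕ∞} :
    ContDiffAt ℝ n (fun t => (t + c)⁻¹) z :=
  (contDiffAt_id.add contDiffAt_const).inv h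

/-- If `f n' = f n * S n` near `z`, where the derivatives of all orders of `S n` at `z` are
rational sequences of geometric type, and if `f n z` is such a sequence up to the factor `w n`,
then so are the derivatives of all orders of `f n` at `z`. -/
lemma exists_iteratedDeriv_of_deriv_eq_mul {f S : ℕ → ℝ → ℝ} {w : ℕ → ℚ} {z : ℝ}
    (hf : ∀ n, ContDiffAt ℝ ∞ (f n) z) (hS : ∀ n, ContDiffAt ℝ ∞ (S n) z)
    (hd : ∀ n, ∀ᶠ t in 𝓝 z, deriv (f n) t = f n t * S n t)
    (h0 : ∃ u, ArithGeom u ∧ ∀ n, f n z = w n * u n)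
    (h1 : ∀ r, ∃ v, ArithGeom v ∧ ∀ n, iteratedDeriv r (S n) z = v n) (r : ℕ) :
    ∃ u, ArithGeom u ∧ ∀ n, iteratedDeriv r (f n) z = w n * u n := by
  induction r using Nat.strong_induction_on with
  | _ r ih =>
    rcases r with _ | r
    · simpa using h0
    · choose! u hu hu' using ih
      choose v hv hv' using h1
      -- Leibniz for `f' = f S`: the derivative of order `r + 1` is `∑ (r choose i) f^(i) S^(r-i)`.
      -- Each summand contains `w n` exactly once.
      refine ⟨fun n => ∑ i ∈ Finset.range (r + 1), (r.choose i : ℚ) * (u i n * v (r - i) n),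
        .sum _ fun i hi => (ArithGeom.const _).mul
          ((hu i (by simpa using hi)).mul (hv _)), fun n => ?_⟩
      have hle : ((r : ℕ) : WithTop ℕ∞) ≤ ∞ := by exact_mod_cast le_top
      rw [iteratedDeriv_succ', (show deriv (f n) =ᶠ[𝓝 z] f n * S n from hd n).iteratedDeriv_eq,
        iteratedDeriv_mul ((hf n).of_le hle) ((hS n).of_le hle)]
      push_cast
      rw [Finset.mul_sum]
      refine Finset.sum_congr rfl fun i hi => ?_
      rw [hu' i (by simpa using hi), hv']
      ring

lemma deriv_prod_add_const {c : ℕ → ℝ} {t : ℝ} (n : ℕ) (h : ∀ m, t + c m ≠ 0) :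
    deriv (fun t => ∏ m ∈ Finset.range n, (t + c m)) t =
      (∏ m ∈ Finset.range n, (t + c m)) * ∑ m ∈ Finset.range n, (t + c m)⁻¹ := by
  have h1 := logDeriv_prod (s := Finset.range n) (f := fun m t => t + c m) (x := t)
    (fun m _ => h m) (fun m _ => by fun_prop)
  have hP : ∏ m ∈ Finset.range n, (t + c m) ≠ 0 := Finset.prod_ne_zero_iff.2 fun m _ => h m
  rw [logDeriv_apply, div_eq_iff hP] at h1
  rw [h1, mul_comm]
  congr 1
  refine Finset.sum_congr rfl fun m _ => ?_
  simp [logDeriv_apply]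

lemma contDiffAt_prod_add_const {c : ℕ → ℝ} {z : ℝ} (n : ℕ) {k : WithTop ℕ∞} :
    ContDiffAt ℝ k (fun t => ∏ m ∈ Finset.range n, (t + c m)) z :=
  contDiffAt_prod fun _ _ => contDiffAt_id.add contDiffAt_const

lemma contDiffAt_sum_inv {c : ℕ → ℝ} {z : ℝ} (n : ℕ) (h : ∀ m, z + c m ≠ 0) {k : WithTop ℕ∞} :
    ContDiffAt ℝ k (fun t => ∑ m ∈ Finset.range n, (t + c m)⁻¹) z :=
  ContDiffAt.sum fun m _ => contDiffAt_add_const_inv (h m)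

lemma iteratedDeriv_sum_inv {c : ℕ → ℝ} {z : ℝ} (n r : ℕ) (h : ∀ m, z + c m ≠ 0) :
    iteratedDeriv r (fun t => ∑ m ∈ Finset.range n, (t + c m)⁻¹) z =
      (-1) ^ r * r ! * ∑ m ∈ Finset.range n, ((z + c m) ^ (r + 1))⁻¹ := by
  rw [iteratedDeriv_fun_sum fun m _ => contDiffAt_add_const_inv (h m), Finset.mul_sum]
  exact Finset.sum_congr rfl fun m _ => iteratedDeriv_add_const_inv _ _ _

lemma ratCast_ne_intCast {z : ℚ} (hz : ∀ m : ℤ, z ≠ m) (m : ℤ) : (z : ℝ) ≠ m := fun h =>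
  hz m (by exact_mod_cast h)

lemma exists_iteratedDeriv_prod_add {z : ℚ} (hz : ∀ m : ℤ, z ≠ m) (r : ℕ) :
    ∃ u, ArithGeom u ∧ ∀ n : ℕ, iteratedDeriv r
      (fun t : ℝ => ∏ m ∈ Finset.range n, (t + m)) z = ((n ! : ℚ) : ℝ) * u n := by
  have hne : ∀ {t : ℝ}, (∀ m : ℤ, t ≠ m) → ∀ m : ℕ, t + (m : ℝ) ≠ 0 := fun ht m =>
    ne_zero_of_ne_intCast (ne_intCast_add_natCast ht m)
  have hz' := ratCast_ne_intCast hz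
  refine exists_iteratedDeriv_of_deriv_eq_mul (w := fun n => (n ! : ℚ))
    (S := fun n t => ∑ m ∈ Finset.range n, (t + m)⁻¹)
    (fun n => contDiffAt_prod_add_const n) (fun n => contDiffAt_sum_inv n (hne hz')) (fun n => ?_)
    ⟨_, arithGeom_prod_div_factorial z, fun n => ?_⟩ (fun r => ⟨_, (ArithGeom.const
      ((-1) ^ r * (r ! : ℚ))).mul (arithGeom_sum_inv_pow hz (r + 1)), fun n => ?_⟩) r
  · filter_upwards [eventually_ne_intCast hz'] with t ht
    exact deriv_prod_add_const n (hne ht)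
  · have : (n ! : ℝ) ≠ 0 := by exact_mod_cast n.factorial_ne_zero
    push_cast
    field_simp
  · rw [iteratedDeriv_sum_inv n r (hne hz')]
    push_cast
    rfl

lemma ne_intCast_one_sub {z : ℚ} (hz : ∀ m : ℤ, z ≠ m) : ∀ m : ℤ, 1 - z ≠ m :=
  fun m h => hz (1 - m) (by push_cast; linarith)

/-- Since `z - 1 - m = -((1 - z) + m)`, the arithmetic estimates are applied to the progression
starting at `1 - z`. -/
lemma exists_iteratedDeriv_inv_prod_sub {z : ℚ} (hz : ∀ m : ℤ, z ≠ m) (r : ℕ) :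
    ∃ u, ArithGeom u ∧ ∀ n : ℕ, iteratedDeriv r
      (fun t : ℝ => (∏ m ∈ Finset.range n, (t + (-1 - m)))⁻¹) z = (((n ! : ℚ)⁻¹ : ℚ) : ℝ) * u n := by
  have hne : ∀ {t : ℝ}, (∀ m : ℤ, t ≠ m) → ∀ m : ℕ, t + (-1 - (m : ℝ)) ≠ 0 := fun {t} ht m => by
    have := ne_zero_of_ne_intCast (ne_intCast_sub_natCast ht (m + 1))
    push_cast at this
    convert this using 1
    ring
  have hP : ∀ {t : ℝ}, (∀ m : ℤ, t ≠ m) → ∀ n : ℕ, ∏ m ∈ Finset.range n, (t + (-1 - (m : ℝ))) ≠ 0 :=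
    fun ht n => Finset.prod_ne_zero_iff.2 fun m _ => hne ht m
  have hz' := ratCast_ne_intCast hz
  have hz1 := ne_intCast_one_sub hz
  refine exists_iteratedDeriv_of_deriv_eq_mul (w := fun n => (n ! : ℚ)⁻¹)
    (f := fun n t => (∏ m ∈ Finset.range n, (t + (-1 - (m : ℝ))))⁻¹)
    (S := fun n t => -∑ m ∈ Finset.range n, (t + (-1 - (m : ℝ)))⁻¹)
    (fun n => (contDiffAt_prod_add_const n).inv (hP hz' n))
    (fun n => (contDiffAt_sum_inv n (hne hz')).neg) (fun n => ?_)
    ⟨_, (arithGeom_const_pow (-1)).mul (arithGeom_factorial_mul_inv_prod hz1), fun n => ?_⟩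
    (fun r => ⟨_, (ArithGeom.const
      ((r ! : ℚ))).mul (arithGeom_sum_inv_pow hz1 (r + 1)), fun n => ?_⟩) r
  · filter_upwards [eventually_ne_intCast hz'] with t ht
    have hPt := hP ht n
    rw [deriv_fun_inv'' ((contDiffAt_prod_add_const n (k := 1)).differentiableAt one_ne_zero) hPt,
      deriv_prod_add_const n (hne ht)]
    field_simp
  · have hf : (n ! : ℝ) ≠ 0 := by exact_mod_cast n.factorial_ne_zero
    have : ∏ m ∈ Finset.range n, ((z : ℝ) + (-1 - m)) =
        (-1) ^ n * ∏ m ∈ Finset.range n, (1 - (z : ℝ) + m) := by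
      nth_rewrite 2 [← Finset.card_range n]
      rw [← Finset.prod_const, ← Finset.prod_mul_distrib]
      exact Finset.prod_congr rfl fun m _ => by ring
    rw [this]
    push_cast
    rw [mul_inv, ← inv_pow, inv_neg, inv_one]
    field_simp
  · rw [iteratedDeriv_fun_neg, iteratedDeriv_sum_inv n r (hne hz')]
    push_cast
    rw [Finset.mul_sum, Finset.mul_sum, ← Finset.sum_neg_distrib]
    refine Finset.sum_congr rfl fun m _ => ?_
    rw [show (z : ℝ) + (-1 - m) = -(1 - z + m) by ring, neg_pow (1 - (z : ℝ) + m), mul_inv, ← inv_pow,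
      inv_neg, inv_one, pow_succ]
    have : ((-1 : ℝ) ^ r) * (-1) ^ r = 1 := by rw [← mul_pow]; simp
    linear_combination (r ! : ℝ) * ((1 - (z : ℝ) + m) ^ (r + 1))⁻¹ * this

/-- Leibniz rule for `Γ(t + e) = f(t) Γ(t)`. -/
lemma iteratedDeriv_Gamma_add {f : ℝ → ℝ} {z e : ℝ} (hz : ∀ m : ℤ, z ≠ m)
    (hf : ContDiffAt ℝ ∞ f z) (h : ∀ᶠ t in 𝓝 z, Real.Gamma (t + e) = f t * Real.Gamma t) (j : ℕ) :
    iteratedDeriv j Real.Gamma (z + e) = ∑ i ∈ Finset.range (j + 1),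
      (j.choose i : ℝ) * iteratedDeriv i f z * iteratedDeriv (j - i) Real.Gamma z := by
  have hle : ((j : ℕ) : WithTop ℕ∞) ≤ ∞ := by exact_mod_cast le_top
  rw [← congrFun (iteratedDeriv_comp_add_const j Real.Gamma e) z,
    (show (fun t => Real.Gamma (t + e)) =ᶠ[𝓝 z] f * Real.Gamma from h).iteratedDeriv_eq,
    iteratedDeriv_mul (hf.of_le hle) (contDiffAt_Gamma hz)]

lemma exists_iteratedDeriv_Gamma_add_natCast {z : ℚ} (hz : ∀ m : ℤ, z ≠ m) :
    ∃ u : ℕ → ℕ → ℚ, (∀ r, ArithGeom (u r)) ∧ ∀ n j : ℕ,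
      iteratedDeriv j Real.Gamma (z + n) = ∑ i ∈ Finset.range (j + 1),
        (j.choose i : ℝ) * (((n ! : ℚ) : ℝ) * u i n) * iteratedDeriv (j - i) Real.Gamma z := by
  choose u hu hu' using exists_iteratedDeriv_prod_add hz
  have hz' := ratCast_ne_intCast hz
  refine ⟨u, hu, fun n j => ?_⟩
  rw [iteratedDeriv_Gamma_add hz' (contDiffAt_prod_add_const n) ((eventually_ne_intCast hz').mono
    fun t ht => Gamma_add_natCast ht n)]
  simp only [hu']

lemma exists_iteratedDeriv_Gamma_sub_natCast {z : ℚ} (hz : ∀ m : ℤ, z ≠ m) :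
    ∃ u : ℕ → ℕ → ℚ, (∀ r, ArithGeom (u r)) ∧ ∀ n j : ℕ,
      iteratedDeriv j Real.Gamma (z + -n) = ∑ i ∈ Finset.range (j + 1),
        (j.choose i : ℝ) * ((((n ! : ℚ)⁻¹ : ℚ) : ℝ) * u i n) *
          iteratedDeriv (j - i) Real.Gamma z := by
  choose u hu hu' using exists_iteratedDeriv_inv_prod_sub hz
  have hz' := ratCast_ne_intCast hz
  refine ⟨u, hu, fun n j => ?_⟩
  rw [iteratedDeriv_Gamma_add (f := fun t => (∏ m ∈ Finset.range n, (t + (-1 - (m : ℝ))))⁻¹) hz'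
    ((contDiffAt_prod_add_const n).inv ?_)
    ((eventually_ne_intCast hz').mono fun t ht => by
      rw [← sub_eq_add_neg]; exact Gamma_sub_natCast ht n)]
  · simp only [hu']
  · refine Finset.prod_ne_zero_iff.2 fun m _ => ?_
    have := ne_zero_of_ne_intCast (ne_intCast_sub_natCast hz' (m + 1))
    push_cast at this
    convert this using 1
    ring

/-! ### The polynomials of the Laplace transform -/

lemma iteratedDeriv_exp_mul_sub (x z : ℝ) (r : ℕ) :
    iteratedDeriv r (fun t => Real.exp (-x * (t - z))) =
      fun t => (-x) ^ r * Real.exp (-x * (t - z)) := by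
  induction r with
  | zero => simp
  | succ r ih =>
    rw [iteratedDeriv_succ, ih]
    funext t
    have h : HasDerivAt (fun t => Real.exp (-x * (t - z))) (Real.exp (-x * (t - z)) * (-x * 1)) t :=
      (((hasDerivAt_id t).sub_const z).const_mul (-x)).exp
    rw [(h.const_mul _).deriv]
    ring

/-- The derivative of order `r` of `e^(-x(t - z))` at `t = z` is `(-x)^r`, so Leibniz packs all the
coefficients into one derivative. Identities between these polynomials then follow from identities
between functions of `t`. -/
lemma eval_laplacePolyPos {γ : ℝ} (hγ : ∀ m : ℤ, γ + 1 ≠ m) (k : ℕ) (x : ℝ) :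
    (laplacePolyPos γ k).eval x =
      iteratedDeriv k (fun t => Real.Gamma t * Real.exp (-x * (t - (γ + 1)))) (γ + 1) := by
  rw [show (fun t => Real.Gamma t * Real.exp (-x * (t - (γ + 1)))) =
    Real.Gamma * fun t => Real.exp (-x * (t - (γ + 1))) from rfl,
    iteratedDeriv_mul (contDiffAt_Gamma hγ) (by fun_prop), laplacePolyPos,
    Polynomial.eval_finsetSum]
  refine Finset.sum_congr rfl fun j _ => ?_
  simp only [iteratedDeriv_exp_mul_sub, Polynomial.eval_mul, Polynomial.eval_C, Polynomial.eval_pow,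
    Polynomial.eval_X, sub_self, mul_zero, Real.exp_zero, mul_one]
  rw [neg_pow x]
  ring

lemma eval_laplacePolyPos_add_natCast {γ : ℝ} (hγ : ∀ m : ℤ, γ + 1 ≠ m) (N k : ℕ) (x : ℝ) :
    (laplacePolyPos (γ + N) k).eval x =
      iteratedDeriv k (fun t => Real.Gamma (t + N) * Real.exp (-x * (t - (γ + 1)))) (γ + 1) := by
  have e : γ + N + 1 = γ + 1 + N := by ring
  rw [eval_laplacePolyPos (by rw [e]; exact ne_intCast_add_natCast hγ N), e,
    ← congrFun (iteratedDeriv_comp_add_const k _ (N : ℝ)) (γ + 1)]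
  congr 1
  funext t
  congr 3
  ring

/-- The formula for `ℒ(x^γ (log x)^k)` that holds for `γ > -1` holds for every `γ ∉ ℤ`. -/
lemma laplacePoly_eq {γ : ℝ} (hγ : ∀ m : ℤ, γ ≠ m) (k : ℕ) :
    laplacePoly γ k = laplacePolyPos γ k := by
  rw [laplacePoly]
  split_ifs with h
  · rfl
  have hz : ∀ m : ℤ, γ + 1 ≠ m := by simpa using ne_intCast_add_natCast hγ 1
  have hne : ∀ {t : ℝ}, (∀ m : ℤ, t ≠ m) → ∀ m : ℕ, t + (m : ℝ) ≠ 0 := fun ht m =>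
    ne_zero_of_ne_intCast (ne_intCast_add_natCast ht m)
  refine Polynomial.funext fun x => ?_
  -- The argument works for any natural number `n`. Partial fractions give `G(t) = 1 / (t(t + 1)⋯(t
  -- + n))`, so `Γ(t) = Γ(t + n + 1) G(t)`, and the double sum of the definition is the Leibniz
  -- expansion of the derivative of order `k` of `H * G`.
  set n := ⌈-γ - 1⌉₊
  set z := γ + 1 with hzdef
  set H : ℝ → ℝ := fun t => Real.Gamma (t + (n + 1 : ℕ)) * Real.exp (-x * (t - z)) with hH
  set c : ℕ → ℝ := fun m => (-1) ^ m / ((m ! : ℝ) * ((n - m)! : ℝ)) with hc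
  set G : ℝ → ℝ := fun t => ∑ m ∈ Finset.range (n + 1), c m * (t + m)⁻¹ with hG
  have hGamma : (fun t => Real.Gamma t * Real.exp (-x * (t - z))) =ᶠ[𝓝 z] H * G := by
    filter_upwards [eventually_ne_intCast hz] with t ht
    have hP : ∏ m ∈ Finset.range (n + 1), (t + (m : ℝ)) ≠ 0 :=
      Finset.prod_ne_zero_iff.2 fun m _ => hne ht m
    have hGt : G t = (∏ m ∈ Finset.range (n + 1), (t + (m : ℝ)))⁻¹ := by
      have hf : (n ! : ℝ) ≠ 0 := by exact_mod_cast n.factorial_ne_zero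
      refine mul_left_cancel₀ hf ?_
      rw [← sum_choose_div_add n t (hne ht), hG, Finset.mul_sum]
      refine Finset.sum_congr rfl fun m hm => ?_
      rw [Nat.cast_choose ℝ (by simpa [Nat.lt_succ_iff] using hm), hc]
      ring
    simp only [Pi.mul_apply, hH, hGt, Gamma_add_natCast ht (n + 1)]
    field_simp
  have hH' : ContDiffAt ℝ k H z := by
    refine ContDiffAt.mul ?_ (by fun_prop)
    exact ContDiffAt.comp (g := Real.Gamma) (f := fun t => t + ((n + 1 : ℕ) : ℝ)) z
      (contDiffAt_Gamma (ne_intCast_add_natCast hz (n + 1))) (contDiffAt_id.add contDiffAt_const)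
  have hG' : ∀ r : ℕ, ∀ m, ContDiffAt ℝ r (fun t => c m * (t + (m : ℝ))⁻¹) z := fun r m =>
    contDiffAt_const.mul (contDiffAt_add_const_inv (hne hz m))
  have hGr : ∀ r : ℕ, iteratedDeriv r G z =
      ∑ m ∈ Finset.range (n + 1), c m * ((-1) ^ r * r ! * ((z + m) ^ (r + 1))⁻¹) := fun r => by
    rw [hG, iteratedDeriv_fun_sum fun m _ => hG' r m]
    refine Finset.sum_congr rfl fun m _ => ?_
    rw [iteratedDeriv_const_mul_field, iteratedDeriv_add_const_inv]
  rw [eval_laplacePolyPos hz, hGamma.iteratedDeriv_eq,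
    iteratedDeriv_mul hH' (show ContDiffAt ℝ k G z from ContDiffAt.sum fun m _ => hG' k m), Polynomial.eval_finsetSum]
  simp only [Polynomial.eval_mul, Polynomial.eval_C, Polynomial.eval_finsetSum, hGr, Finset.mul_sum]
  rw [Finset.sum_comm]
  refine Finset.sum_congr rfl fun l hl => Finset.sum_congr rfl fun m _ => ?_
  have hl' : l ≤ k := by simpa [Nat.lt_succ_iff] using hl
  have e1 : γ + (n : ℝ) + 1 = γ + (n + 1 : ℕ) := by push_cast; ring
  have e2 : (m : ℝ) + γ + 1 = z + m := by rw [hzdef]; ring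
  have e3 : (laplacePolyPos (γ + (n + 1 : ℕ)) l).eval x = iteratedDeriv l H z :=
    eval_laplacePolyPos_add_natCast hz (n + 1) l x
  rw [e1, e3, e2, Nat.cast_choose ℝ hl', pow_succ, mul_inv]
  have f1 : ((k - l)! : ℝ) ≠ 0 := by exact_mod_cast (k - l).factorial_ne_zero
  have f2 : (l ! : ℝ) ≠ 0 := by exact_mod_cast l.factorial_ne_zero
  have f3 := hne hz m
  simp only [hc]
  field_simp

/-- Used with `e n = ±n` and `w n = n!^(±1)`. The indices are the pairs `(j, i)` with `j` the order
of derivation of `Γ` and `i` the Leibniz index. What matters is that `T`, `c` and `p` do not depend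
on `n`. -/
lemma exists_laplacePoly_expansion {γ : ℚ} {e : ℕ → ℝ} {w : ℕ → ℚ}
    (he : ∀ n, ∀ m : ℤ, (γ : ℝ) + e n ≠ m)
    (h : ∃ u : ℕ → ℕ → ℚ, (∀ r, ArithGeom (u r)) ∧ ∀ n j : ℕ,
      iteratedDeriv j Real.Gamma ((γ + 1 : ℚ) + e n) = ∑ i ∈ Finset.range (j + 1),
        (j.choose i : ℝ) * ((w n : ℝ) * u i n) * iteratedDeriv (j - i) Real.Gamma (γ + 1 : ℚ))
    (k : ℕ) :
    ∃ (T : Finset (Σ _ : ℕ, ℕ)) (c : (Σ _ : ℕ, ℕ) → ℝ) (v : (Σ _ : ℕ, ℕ) → ℕ → ℚ)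
      (p : (Σ _ : ℕ, ℕ) → ℕ), (∀ t, ArithGeom (v t)) ∧ ∀ n, laplacePoly (γ + e n) k =
        ∑ t ∈ T, Polynomial.C (c t * ((w n * v t n : ℚ) : ℝ)) * Polynomial.X ^ p t := by
  obtain ⟨u, hu, hu'⟩ := h
  refine ⟨(Finset.range (k + 1)).sigma fun j => Finset.range (j + 1), fun t =>
    (k.choose t.1 : ℝ) * (-1) ^ (k - t.1) * ((t.1.choose t.2 : ℝ) *
      iteratedDeriv (t.1 - t.2) Real.Gamma (γ + 1 : ℚ)), fun t => u t.2, fun t => k - t.1,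
    fun t => hu _, fun n => ?_⟩
  rw [laplacePoly_eq (he n), laplacePolyPos, Finset.sum_sigma]
  refine Finset.sum_congr rfl fun j _ => ?_
  rw [show (γ : ℝ) + e n + 1 = ((γ + 1 : ℚ) : ℝ) + e n by push_cast; ring, hu', Finset.mul_sum,
    Finset.sum_mul, map_sum, Finset.sum_mul]
  refine Finset.sum_congr rfl fun i _ => ?_
  congr 2
  push_cast
  ring

lemma exists_laplacePoly_add_natCast {γ : ℚ} (hγ : ∀ m : ℤ, γ ≠ m) (k : ℕ) :
    ∃ (T : Finset (Σ _ : ℕ, ℕ)) (c : (Σ _ : ℕ, ℕ) → ℝ) (v : (Σ _ : ℕ, ℕ) → ℕ → ℚ)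
      (p : (Σ _ : ℕ, ℕ) → ℕ), (∀ t, ArithGeom (v t)) ∧ ∀ n : ℕ, laplacePoly (γ + n) k =
        ∑ t ∈ T, Polynomial.C (c t * ((n ! * v t n : ℚ) : ℝ)) * Polynomial.X ^ p t :=
  exists_laplacePoly_expansion (e := fun n => n) (w := fun n => n !)
    (ne_intCast_add_natCast (ratCast_ne_intCast hγ))
    (exists_iteratedDeriv_Gamma_add_natCast
      fun m h => hγ (m - 1) (by push_cast; linarith)) k

lemma exists_laplacePoly_sub_natCast {γ : ℚ} (hγ : ∀ m : ℤ, γ ≠ m) (k : ℕ) :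
    ∃ (T : Finset (Σ _ : ℕ, ℕ)) (c : (Σ _ : ℕ, ℕ) → ℝ) (v : (Σ _ : ℕ, ℕ) → ℕ → ℚ)
      (p : (Σ _ : ℕ, ℕ) → ℕ), (∀ t, ArithGeom (v t)) ∧ ∀ n : ℕ, laplacePoly (γ + -n) k =
        ∑ t ∈ T, Polynomial.C (c t * (((n ! : ℚ)⁻¹ * v t n : ℚ) : ℝ)) * Polynomial.X ^ p t :=
  exists_laplacePoly_expansion (e := fun n => -n) (w := fun n => (n ! : ℚ)⁻¹)
    (fun n => by simpa [sub_eq_add_neg] using ne_intCast_sub_natCast (ratCast_ne_intCast hγ) n)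
    (exists_iteratedDeriv_Gamma_sub_natCast
      fun m h => hγ (m - 1) (by push_cast; linarith)) k

lemma coeff_laplacePoly {γ : ℝ} (hγ : ∀ m : ℤ, γ ≠ m) (k l : ℕ) :
    (laplacePoly γ k).coeff l = ∑ j ∈ Finset.range (k + 1), if l = k - j then
      (k.choose j : ℝ) * iteratedDeriv j Real.Gamma (γ + 1) * (-1) ^ (k - j) else 0 := by
  rw [laplacePoly_eq hγ, laplacePolyPos, Polynomial.finsetSum_coeff]
  exact Finset.sum_congr rfl fun j _ => Polynomial.coeff_C_mul_X_pow _ _ _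

/-- The leading coefficient of the polynomial of the Laplace transform is nonzero. -/
lemma coeff_laplacePoly_self_ne_zero {γ : ℝ} (hγ : ∀ m : ℤ, γ ≠ m) (k : ℕ) :
    (laplacePoly γ k).coeff k ≠ 0 := by
  have hz : ∀ m : ℤ, γ + 1 ≠ m := by simpa using ne_intCast_add_natCast hγ 1
  rw [coeff_laplacePoly hγ, Finset.sum_eq_single_of_mem 0 (by simp)]
  · have : Real.Gamma (γ + 1) ≠ 0 := Real.Gamma_ne_zero fun m h => hz (-m) (by push_cast; exact h)
    simpa using this
  · intro j hj hj0
    have := Finset.mem_range.1 hj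
    exact if_neg (by omega)

lemma coeff_laplacePoly_eq_zero {γ : ℝ} (hγ : ∀ m : ℤ, γ ≠ m) {k l : ℕ} (h : k < l) :
    (laplacePoly γ k).coeff l = 0 := by
  rw [coeff_laplacePoly hγ]
  exact Finset.sum_eq_zero fun j _ => if_neg (by omega)

/-! ### Multiplying the coefficients of a Gevrey series by rational numbers -/

/-- For `q ≠ 0`, the conjugates of `q x` are `q` times those of `x`. -/
lemma norm_le_of_mem_rootSet_minpoly_ratCast_mul {x w : ℂ} {q : ℚ} {B : ℝ}
    (hB : ∀ w ∈ (minpoly ℚ x).rootSet ℂ, ‖w‖ ≤ B) (hw : w ∈ (minpoly ℚ ((q : ℂ) * x)).rootSet ℂ) :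
    ‖w‖ ≤ |(q : ℝ)| * B := by
  rcases eq_or_ne q 0 with rfl | hq
  · have : w = 0 := by simpa [minpoly.zero, Polynomial.mem_rootSet] using hw
    simp [this]
  have hq' : (q : ℂ) ≠ 0 := by exact_mod_cast hq
  rw [Polynomial.mem_rootSet] at hw
  obtain ⟨h0, hw⟩ := hw
  have hint : IsIntegral ℚ ((q : ℂ) * x) := by
    by_contra h
    exact h0 (minpoly.eq_zero h)
  have hx : IsIntegral ℚ x := by
    have := hint.smul (q⁻¹ : ℚ)
    rwa [Algebra.smul_def, eq_ratCast, Rat.cast_inv, inv_mul_cancel_left₀ hq'] at this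
  have hdvd : minpoly ℚ ((q : ℂ) * x) ∣
      (minpoly ℚ x).comp (Polynomial.C q⁻¹ * Polynomial.X) := by
    refine minpoly.dvd _ _ ?_
    rw [Polynomial.aeval_comp]
    simp [hq', minpoly.aeval]
  have hroot : Polynomial.aeval ((q : ℂ)⁻¹ * w) (minpoly ℚ x) = 0 := by
    have := Polynomial.aeval_eq_zero_of_dvd_aeval_eq_zero hdvd hw
    rw [Polynomial.aeval_comp] at this
    simpa using this
  have h := hB _ (Polynomial.mem_rootSet.2 ⟨minpoly.ne_zero hx, hroot⟩)
  rw [norm_mul, norm_inv, Complex.norm_ratCast, inv_mul_le_iff₀ (by positivity)] at h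
  exact h

/-- Each `α i` is at most `|α| ≤ n`, so the one-variable bounds and denominators at index `n` serve
all such `α` and can be multiplied over the variables. -/
lemma ArithGeom.exists_prod {d : ℕ} {v : Fin d → ℕ → ℚ} (hv : ∀ i, ArithGeom (v i)) :
    ∃ C : ℝ, 1 ≤ C ∧ ∀ n, (∀ α : Fin d →₀ ℕ, α.degree ≤ n → |((∏ i, v i (α i) : ℚ) : ℝ)| ≤ C ^ (n + 1)) ∧
      ∃ D : ℕ, 0 < D ∧ (D : ℝ) ≤ C ^ (n + 1) ∧
        ∀ α : Fin d →₀ ℕ, α.degree ≤ n → ∃ z : ℤ, (D : ℚ) * ∏ i, v i (α i) = z := by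
  choose C hC h using hv
  choose hb D hD hDC hDz using h
  have hdeg : ∀ (α : Fin d →₀ ℕ) n, α.degree ≤ n → ∀ i, α i ≤ n := fun α n h i =>
    (Finsupp.le_degree i α).trans h
  refine ⟨∏ i, C i, Finset.one_le_prod fun i _ => hC i, fun n => ⟨fun α hα => ?_,
    ∏ i, D i n, Finset.prod_pos fun i _ => hD i n, ?_, fun α hα => ?_⟩⟩
  · rw [Rat.cast_prod, Finset.abs_prod, ← Finset.prod_pow]
    refine Finset.prod_le_prod (fun _ _ => abs_nonneg _) fun i _ => (hb i (α i)).trans ?_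
    exact pow_le_pow_right₀ (hC i) (by have := hdeg α n hα i; omega)
  · rw [Nat.cast_prod, ← Finset.prod_pow]
    exact Finset.prod_le_prod (fun _ _ => by positivity) fun i _ => hDC i n
  · choose z hz using fun i => hDz i n (α i) (hdeg α n hα i)
    refine ⟨∏ i, z i, ?_⟩
    push_cast
    rw [← Finset.prod_mul_distrib]
    exact Finset.prod_congr rfl fun i _ => hz i

section Gevrey

variable {K : Type*} [Field K] {d : ℕ}

/-- The series whose coefficients are those of `f` multiplied by the rational numbers `u α`. -/
def mulCoeff (u : (Fin d →₀ ℕ) → ℚ) (f : MvPowerSeries (Fin d) K) : MvPowerSeries (Fin d) K :=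
  fun α => (u α : K) * MvPowerSeries.coeff α f

lemma coeff_mulCoeff (u : (Fin d →₀ ℕ) → ℚ) (f : MvPowerSeries (Fin d) K) (α : Fin d →₀ ℕ) :
    MvPowerSeries.coeff α (mulCoeff u f) = (u α : K) * MvPowerSeries.coeff α f := rfl

/-- The product of the `w (α i)` is exactly the change of normalisation `(α!)^(s' - s)`, so the
normalised coefficients are only multiplied by the rational numbers `∏ v i (α i)`. -/
lemma IsArithGevrey.mulCoeff [Algebra K ℂ] {s s' : ℚ} {f : MvPowerSeries (Fin d) K}
    (hf : IsArithGevrey s f) {w : ℕ → ℚ} (hw : ∀ n, (w n : ℝ) = (n ! : ℝ) ^ ((s' - s : ℚ) : ℝ))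
    {v : Fin d → ℕ → ℚ} (hv : ∀ i, ArithGeom (v i)) :
    IsArithGevrey s' (mulCoeff (fun α => ∏ i, (w (α i) * v i (α i))) f) := by
  obtain ⟨C, hC, h⟩ := ArithGeom.exists_prod hv
  have key : ∀ α, normCoeff s' (NilssonGevrey.mulCoeff (fun α => ∏ i, (w (α i) * v i (α i))) f) α =
      ((∏ i, v i (α i) : ℚ) : ℂ) * normCoeff s f α := fun α => by
    have hpos : (0 : ℝ) < ((∏ i, (α i)! : ℕ) : ℝ) := by
      exact_mod_cast Finset.prod_pos fun i _ => (α i).factorial_pos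
    have hW : ((∏ i, w (α i) : ℚ) : ℝ) * ((∏ i, (α i)! : ℕ) : ℝ) ^ (s : ℝ) =
        ((∏ i, (α i)! : ℕ) : ℝ) ^ (s' : ℝ) := by
      rw [show (s' : ℝ) = ((s' - s : ℚ) : ℝ) + s by push_cast; ring, Real.rpow_add hpos]
      congr 1
      push_cast
      rw [← Real.finsetProd_rpow _ _ fun i _ => Nat.cast_nonneg _]
      exact Finset.prod_congr rfl fun i _ => by rw [hw]; push_cast; rfl
    have h1 : (((((∏ i, (α i)! : ℕ) : ℝ) ^ (s : ℝ) : ℝ)) : ℂ) ≠ 0 := by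
      exact_mod_cast (Real.rpow_pos_of_pos hpos _).ne'
    have h2 : (((((∏ i, (α i)! : ℕ) : ℝ) ^ (s' : ℝ) : ℝ)) : ℂ) ≠ 0 := by
      exact_mod_cast (Real.rpow_pos_of_pos hpos _).ne'
    have hW' : ((∏ i, w (α i) : ℚ) : ℂ) * ((((∏ i, (α i)! : ℕ) : ℝ) ^ (s : ℝ) : ℝ) : ℂ) =
        ((((∏ i, (α i)! : ℕ) : ℝ) ^ (s' : ℝ) : ℝ) : ℂ) := by
      rw [← hW, Complex.ofReal_mul, Complex.ofReal_ratCast]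
    rw [normCoeff, normCoeff, coeff_mulCoeff, map_mul, map_ratCast, Finset.prod_mul_distrib,
      Rat.cast_mul, mul_div_assoc', div_eq_div_iff h2 h1, ← hW']
    ring
  constructor
  · obtain ⟨A, hA, hc⟩ := hf.conj_le
    refine ⟨C * A, by positivity, fun α w hw => ?_⟩
    rw [key] at hw
    refine (norm_le_of_mem_rootSet_minpoly_ratCast_mul (hc α) hw).trans ?_
    rw [mul_pow]
    have := (h α.degree).1 α le_rfl
    gcongr
  · obtain ⟨A, hA, hd⟩ := hf.denom_le
    refine ⟨C * A, by positivity, fun n => ?_⟩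
    obtain ⟨D, hD, hDA, hDz⟩ := hd n
    obtain ⟨-, E, hE, hEC, hEz⟩ := h n
    refine ⟨E * D, Nat.mul_pos hE hD, ?_, fun α hα => ?_⟩
    · rw [mul_pow]
      push_cast
      gcongr
    · obtain ⟨z, hz⟩ := hEz α hα
      have hz' : (E : ℂ) * ((∏ i, v i (α i) : ℚ) : ℂ) = z := by exact_mod_cast congrArg (Rat.cast : ℚ → ℂ) hz
      rw [key, show ((E * D : ℕ) : ℂ) * (((∏ i, v i (α i) : ℚ) : ℂ) * normCoeff s f α) =
        (z : ℂ) * (D * normCoeff s f α) by rw [← hz']; push_cast; ring]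
      exact (isIntegral_algebraMap (R := ℤ) (A := ℂ) (x := z)).mul (hDz α hα)

end Gevrey

/-! ### The Laplace transform of a term -/

section Term

variable {d : ℕ}

lemma laplaceAt_monomial (β : Expo d) (k : Fin d →₀ ℕ) (a : ℂ) :
    laplaceAt β (MvPolynomial.monomial k a) =
      a • ∏ i, Polynomial.aeval (MvPolynomial.X i : MvPolynomial (Fin d) ℂ)
        (laplacePoly (β.1 i : ℝ) (k i)) := by
  have h := (MvPolynomial.basisMonomials (Fin d) ℂ).constr_basis ℂ (fun k : Fin d →₀ ℕ =>
    ∏ i, Polynomial.aeval (MvPolynomial.X i : MvPolynomial (Fin d) ℂ)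
      (laplacePoly (β.1 i : ℝ) (k i))) k
  rw [MvPolynomial.coe_basisMonomials] at h
  rw [← mul_one a, ← smul_eq_mul, ← MvPolynomial.smul_monomial, map_smul, laplaceAt, h, smul_eq_mul,
    mul_one]

lemma prod_aeval_X_sum {τ : Type*} [DecidableEq τ] (T : Fin d → Finset τ) (c : Fin d → τ → ℝ)
    (p : Fin d → τ → ℕ) :
    ∏ i, Polynomial.aeval (MvPolynomial.X i : MvPolynomial (Fin d) ℂ)
      (∑ t ∈ T i, Polynomial.C (c i t) * Polynomial.X ^ p i t) =
    ∑ t ∈ Fintype.piFinset T, MvPolynomial.monomial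
      (Finsupp.equivFunOnFinite.symm fun i => p i (t i)) (∏ i, (c i (t i) : ℂ)) := by
  simp only [map_sum]
  rw [Finset.prod_univ_sum]
  refine Finset.sum_congr rfl fun t _ => ?_
  rw [MvPolynomial.monomial_eq, map_prod, Finsupp.prod_fintype _ _ fun i => pow_zero _,
    ← Finset.prod_mul_distrib]
  refine Finset.prod_congr rfl fun i _ => ?_
  simp only [map_mul, Polynomial.aeval_C, map_pow, Polynomial.aeval_X, Finsupp.equivFunOnFinite_symm_apply_apply]
  rfl

lemma coeff_prod_aeval_X (P : Fin d → Polynomial ℝ) (l : Fin d →₀ ℕ) :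
    MvPolynomial.coeff l (∏ i, Polynomial.aeval (MvPolynomial.X i : MvPolynomial (Fin d) ℂ) (P i)) =
      ∏ i, ((P i).coeff (l i) : ℂ) := by
  have h := prod_aeval_X_sum (fun i => (P i).support) (fun i t => (P i).coeff t) fun _ t => t
  simp only [← Polynomial.as_sum_support_C_mul_X_pow] at h
  rw [h, MvPolynomial.coeff_sum]
  simp only [MvPolynomial.coeff_monomial]
  by_cases hl : ∀ i, (P i).coeff (l i) ≠ 0
  · rw [Finset.sum_eq_single_of_mem (fun i => l i)]
    · rw [if_pos]
      ext i
      simp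
    · simpa using hl
    · intro t _ ht
      refine if_neg fun h => ht ?_
      rw [← h]
      funext i
      simp
  · push Not at hl
    obtain ⟨i, hi⟩ := hl
    rw [Finset.prod_eq_zero (Finset.mem_univ i) (by simp [hi])]
    refine Finset.sum_eq_zero fun t ht => if_neg fun h => ?_
    have := (Fintype.mem_piFinset.1 ht) i
    rw [Polynomial.mem_support_iff] at this
    rw [← h] at hi
    exact this (by simpa using hi)

lemma laplaceAt_injective (β : Expo d) : Function.Injective (laplaceAt β) := by
  rw [← LinearMap.ker_eq_bot, LinearMap.ker_eq_bot']
  intro p hp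
  by_contra hne
  -- The transform of a monomial `l` involves only exponents `≤ l` componentwise. For `k` of maximal
  -- total degree in the support, no other monomial of `p` contributes to the coefficient at `k`.
  obtain ⟨k, hk, hmax⟩ := p.support.exists_max_image Finsupp.degree
    (MvPolynomial.support_nonempty.2 hne)
  have hβ : ∀ i, ∀ m : ℤ, (β.1 i : ℝ) ≠ m := fun i => ratCast_ne_intCast (β.2 i)
  have h : MvPolynomial.coeff k (laplaceAt β p) =
      MvPolynomial.coeff k p * ∏ i, ((laplacePoly (β.1 i : ℝ) (k i)).coeff (k i) : ℂ) := by
    conv_lhs => rw [p.as_sum]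
    rw [map_sum, MvPolynomial.coeff_sum, Finset.sum_eq_single_of_mem k hk]
    · rw [laplaceAt_monomial, MvPolynomial.coeff_smul, coeff_prod_aeval_X, smul_eq_mul]
    · intro l hl hlk
      rw [laplaceAt_monomial, MvPolynomial.coeff_smul, coeff_prod_aeval_X]
      obtain ⟨i, hi⟩ : ∃ i, l i < k i := by
        by_contra! hle
        have hle' : k ≤ l := hle
        obtain ⟨m, rfl⟩ := exists_add_of_le hle'
        have := hmax _ hl
        rw [map_add] at this
        have hm : m = 0 := (Finsupp.degree_eq_zero_iff m).1 (by omega)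
        exact hlk (by simp [hm])
      rw [Finset.prod_eq_zero (Finset.mem_univ i)
        (by rw [coeff_laplacePoly_eq_zero (hβ i) hi, Complex.ofReal_zero]), smul_zero]
  rw [hp, MvPolynomial.coeff_zero, eq_comm, mul_eq_zero, Finset.prod_eq_zero_iff] at h
  rcases h with h | ⟨i, -, h⟩
  · exact MvPolynomial.mem_support_iff.1 hk h
  · exact coeff_laplacePoly_self_ne_zero (hβ i) (k i) (by exact_mod_cast h)

lemma Expo.dual_dual (β : Expo d) : β.dual.dual = β := Subtype.ext (funext fun i => by
  simp [Expo.dual])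

lemma laplace_injective : Function.Injective (laplace (d := d)) := by
  intro F G h
  funext β
  have := congrFun h β.dual
  simp only [laplace, LinearMap.pi_apply, LinearMap.comp_apply, LinearMap.proj_apply,
    Expo.dual_dual] at this
  exact laplaceAt_injective β this

variable {K : Type*} [Field K]

lemma nilssonTerm_apply (f : MvPowerSeries (Fin d) K) {γ β : Expo d} (k : Fin d →₀ ℕ)
    {α : Fin d →₀ ℕ} (h : ∀ i, β.1 i = γ.1 i + α i) :
    nilssonTerm f γ k β = MvPolynomial.monomial k (MvPowerSeries.coeff α f) := by
  have h' : ∃ α : Fin d →₀ ℕ, ∀ i, β.1 i = γ.1 i + α i := ⟨α, h⟩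
  have : h'.choose = α := Finsupp.ext fun i => by
    have := h'.choose_spec i
    rw [h i, add_right_inj] at this
    exact_mod_cast this.symm
  rw [nilssonTerm, dif_pos h', this]

lemma nilssonTerm_apply_of_not_exists (f : MvPowerSeries (Fin d) K) {γ β : Expo d}
    (k : Fin d →₀ ℕ) (h : ¬∃ α : Fin d →₀ ℕ, ∀ i, β.1 i = γ.1 i + α i) :
    nilssonTerm f γ k β = 0 := dif_neg h

lemma nilssonTermInv_apply (f : MvPowerSeries (Fin d) K) {γ β : Expo d} (k : Fin d →₀ ℕ)
    {α : Fin d →₀ ℕ} (h : ∀ i, β.1 i = γ.1 i - α i) :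
    nilssonTermInv f γ k β = MvPolynomial.monomial k (MvPowerSeries.coeff α f) := by
  have h' : ∃ α : Fin d →₀ ℕ, ∀ i, β.1 i = γ.1 i - α i := ⟨α, h⟩
  have : h'.choose = α := Finsupp.ext fun i => by
    have := h'.choose_spec i
    rw [h i, sub_right_inj] at this
    exact_mod_cast this.symm
  rw [nilssonTermInv, dif_pos h', this]

lemma nilssonTermInv_apply_of_not_exists (f : MvPowerSeries (Fin d) K) {γ β : Expo d}
    (k : Fin d →₀ ℕ) (h : ¬∃ α : Fin d →₀ ℕ, ∀ i, β.1 i = γ.1 i - α i) :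
    nilssonTermInv f γ k β = 0 := dif_neg h

variable [Algebra K ℂ]

lemma complexify_apply (F : LogSeries d K) (β : Expo d) :
    complexify F β = MvPolynomial.map (algebraMap K ℂ) (F β) := rfl

lemma laplace_complexify_apply (F : LogSeries d K) (β : Expo d) :
    laplace (complexify F) β =
      laplaceAt β.dual (MvPolynomial.map (algebraMap K ℂ) (F β.dual)) := rfl

lemma toSeries_tmul (N : Submodule K (LogSeries d K)) (z : ℂ) (F : N) :
    toSeries N (z ⊗ₜ F) = z • complexify (F : LogSeries d K) := rfl

lemma smul_complexify_mem_range_toSeries {N : Submodule K (LogSeries d K)} (z : ℂ)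
    {F : LogSeries d K} (hF : F ∈ N) : z • complexify F ∈ LinearMap.range (toSeries N) :=
  ⟨z ⊗ₜ ⟨F, hF⟩, toSeries_tmul N z ⟨F, hF⟩⟩

lemma complexify_injective : Function.Injective (complexify (K := K) (d := d)) := by
  intro F G h
  funext β
  exact MvPolynomial.map_injective _ (algebraMap K ℂ).injective (congrFun h β)

/-- If `ℒ(x^(γ_i + e(n)) (log x)^(k_i))` is a combination of the sequences `w * v i t` for `t ∈ T i`,
the Laplace transform of `a x^β (log x)^k` with `β = γ + e(α)` is a sum over `∏ i, T i`. -/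
lemma laplaceAt_monomial_eq_sum {τ : Type*} [DecidableEq τ] {β : Expo d} {k α : Fin d →₀ ℕ}
    {w : ℕ → ℚ} {T : Fin d → Finset τ} {c : Fin d → τ → ℝ} {v : Fin d → τ → ℕ → ℚ}
    {p : Fin d → τ → ℕ}
    (h : ∀ i, laplacePoly (β.1 i) (k i) = ∑ t ∈ T i,
      Polynomial.C (c i t * ((w (α i) * v i t (α i) : ℚ) : ℝ)) * Polynomial.X ^ p i t)
    (f : MvPowerSeries (Fin d) K) :
    laplaceAt β (MvPolynomial.map (algebraMap K ℂ)
      (MvPolynomial.monomial k (MvPowerSeries.coeff α f))) =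
    ∑ t ∈ Fintype.piFinset T, (∏ i, (c i (t i) : ℂ)) • MvPolynomial.map (algebraMap K ℂ)
      (MvPolynomial.monomial (Finsupp.equivFunOnFinite.symm fun i => p i (t i))
        (MvPowerSeries.coeff α (mulCoeff (fun α => ∏ i, (w (α i) * v i (t i) (α i))) f))) := by
  rw [MvPolynomial.map_monomial, laplaceAt_monomial]
  simp only [h]
  rw [prod_aeval_X_sum, Finset.smul_sum]
  refine Finset.sum_congr rfl fun t _ => ?_
  rw [MvPolynomial.map_monomial, MvPolynomial.smul_monomial, MvPolynomial.smul_monomial,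
    coeff_mulCoeff, map_mul, map_ratCast]
  congr 1
  push_cast
  simp only [smul_eq_mul, Finset.prod_mul_distrib]
  ring

/-- The constants and log exponents of the expansion are independent of `α`, so each choice of one
summand per variable gives a complex multiple of a single term `g(1/x) x^(-γ-1) (log x)^p`. -/
lemma laplace_nilssonTerm_mem {s : ℚ} {f : MvPowerSeries (Fin d) K} (hf : IsArithGevrey s f)
    (γ : Expo d) (k : Fin d →₀ ℕ) :
    laplace (complexify (nilssonTerm f γ k)) ∈
      LinearMap.range (toSeries (NGAInv K d (s + 1))) := by
  classical
  choose T c v p hv h using fun i => exists_laplacePoly_add_natCast (γ.2 i) (k i)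
  have key : laplace (complexify (nilssonTerm f γ k)) = ∑ t ∈ Fintype.piFinset T,
      (∏ i, (c i (t i) : ℂ)) • complexify (nilssonTermInv
        (mulCoeff (fun α => ∏ i, ((α i)! * v i (t i) (α i))) f) γ.dual
        (Finsupp.equivFunOnFinite.symm fun i => p i (t i))) := by
    funext β
    rw [laplace_complexify_apply, Finset.sum_apply]
    simp only [Pi.smul_apply, complexify_apply]
    by_cases hα : ∃ α : Fin d →₀ ℕ, ∀ i, β.1 i = γ.dual.1 i - α i
    · obtain ⟨α, hα⟩ := hα
      have hα' : ∀ i, β.dual.1 i = γ.1 i + α i := fun i => by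
        have := hα i
        simp only [Expo.dual] at this ⊢
        linarith
      simp only [nilssonTerm_apply f k hα', nilssonTermInv_apply _ _ hα]
      exact laplaceAt_monomial_eq_sum (w := fun n => (n ! : ℚ)) (fun i => by
        rw [hα' i, ← h]; push_cast; rfl) f
    · rw [nilssonTerm_apply_of_not_exists, map_zero, map_zero]
      · simp only [nilssonTermInv_apply_of_not_exists _ _ hα, map_zero, smul_zero,
          Finset.sum_const_zero]
      · rintro ⟨α, h⟩
        refine hα ⟨α, fun i => ?_⟩
        have := h i
        simp only [Expo.dual] at this ⊢
        linarith
  rw [key]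
  refine Submodule.sum_mem _ fun t _ => smul_complexify_mem_range_toSeries _
    (Submodule.subset_span ⟨_, _, _, hf.mulCoeff (w := fun n => (n ! : ℚ)) (fun n => ?_)
      fun i => hv i (t i), rfl⟩)
  simp

lemma laplace_nilssonTermInv_mem {s : ℚ} {f : MvPowerSeries (Fin d) K} (hf : IsArithGevrey s f)
    (γ : Expo d) (k : Fin d →₀ ℕ) :
    laplace (complexify (nilssonTermInv f γ k)) ∈
      LinearMap.range (toSeries (NGA K d (s - 1))) := by
  classical
  choose T c v p hv h using fun i => exists_laplacePoly_sub_natCast (γ.2 i) (k i)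
  have key : laplace (complexify (nilssonTermInv f γ k)) = ∑ t ∈ Fintype.piFinset T,
      (∏ i, (c i (t i) : ℂ)) • complexify (nilssonTerm
        (mulCoeff (fun α => ∏ i, (((α i)! : ℚ)⁻¹ * v i (t i) (α i))) f) γ.dual
        (Finsupp.equivFunOnFinite.symm fun i => p i (t i))) := by
    funext β
    rw [laplace_complexify_apply, Finset.sum_apply]
    simp only [Pi.smul_apply, complexify_apply]
    by_cases hα : ∃ α : Fin d →₀ ℕ, ∀ i, β.1 i = γ.dual.1 i + α i
    · obtain ⟨α, hα⟩ := hα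
      have hα' : ∀ i, β.dual.1 i = γ.1 i - α i := fun i => by
        have := hα i
        simp only [Expo.dual] at this ⊢
        linarith
      simp only [nilssonTermInv_apply f k hα', nilssonTerm_apply _ _ hα]
      exact laplaceAt_monomial_eq_sum (w := fun n => (n ! : ℚ)⁻¹) (fun i => by
        rw [hα' i, ← h, sub_eq_add_neg]; push_cast; rfl) f
    · rw [nilssonTermInv_apply_of_not_exists, map_zero, map_zero]
      · simp only [nilssonTerm_apply_of_not_exists _ _ hα, map_zero, smul_zero,
          Finset.sum_const_zero]
      · rintro ⟨α, h⟩
        refine hα ⟨α, fun i => ?_⟩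
        have := h i
        simp only [Expo.dual] at this ⊢
        linarith
  rw [key]
  refine Submodule.sum_mem _ fun t _ => smul_complexify_mem_range_toSeries _
    (Submodule.subset_span ⟨_, _, _, hf.mulCoeff (w := fun n => (n ! : ℚ)⁻¹) (fun n => ?_)
      fun i => hv i (t i), rfl⟩)
  simp [Real.rpow_neg_one]

/-- The Laplace transform lifts to `ℂ ⊗ N'` on a span of series whose transforms are represented
there. -/
lemma exists_injective_lift_laplace {S : Set (LogSeries d K)} {N' : Submodule K (LogSeries d K)}
    (h : ∀ F ∈ S, laplace (complexify F) ∈ LinearMap.range (toSeries N')) :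
    ∃ L : Submodule.span K S →ₗ[K] ℂ ⊗[K] N', Function.Injective L ∧
      ∀ F : Submodule.span K S,
        toSeries N' (L F) = laplace (complexify (F : LogSeries d K)) := by
  set Φ : LogSeries d K →ₗ[K] LogSeries d ℂ := laplace.restrictScalars K ∘ₗ complexify
  have hmem : ∀ F ∈ Submodule.span K S, Φ F ∈ LinearMap.range (toSeries N') :=
    fun F hF => (Submodule.span_le (p := (LinearMap.range (toSeries N')).comap Φ)).2 h hF
  -- A vector space is projective, so the map lifts through the surjection onto the range.
  -- Injectivity of `toSeries` is not required: that of `L` follows from the injectivity of the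
  -- composite.
  obtain ⟨L, hL⟩ := Module.projective_lifting_property (toSeries N').rangeRestrict
    ((Φ ∘ₗ (Submodule.span K S).subtype).codRestrict _ fun F => hmem F F.2)
    (toSeries N').surjective_rangeRestrict
  have hL' : ∀ F : Submodule.span K S,
      toSeries N' (L F) = laplace (complexify (F : LogSeries d K)) := fun F =>
    congrArg Subtype.val (LinearMap.congr_fun hL F)
  refine ⟨L, fun F G hFG => Subtype.ext (complexify_injective (laplace_injective ?_)), hL'⟩
  rw [← hL', ← hL', hFG]

end Term

end NilssonGevrey
end

open NilssonGevrey in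
theorem proposition3p9 (K : Type*) [Field K] [NumberField K] [Algebra K ℂ]
    (d : ℕ) (hd : 0 < d) (s : ℚ) :
    (∃ L : NGA K d s →ₗ[K] ℂ ⊗[K] NGAInv K d (s + 1),
      Function.Injective L ∧
      ∀ F : NGA K d s,
        toSeries (NGAInv K d (s + 1)) (L F) = laplace (complexify (F : LogSeries d K))) ∧
    (∃ L : NGAInv K d s →ₗ[K] ℂ ⊗[K] NGA K d (s - 1),
      Function.Injective L ∧
      ∀ F : NGAInv K d s,
        toSeries (NGA K d (s - 1)) (L F) = laplace (complexify (F : LogSeries d K))) := by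
  refine ⟨exists_injective_lift_laplace ?_, exists_injective_lift_laplace ?_⟩
  · rintro _ ⟨f, γ, k, hf, rfl⟩
    exact laplace_nilssonTerm_mem hf γ k
  · rintro _ ⟨f, γ, k, hf, rfl⟩
    exact laplace_nilssonTermInv_mem hf γ k
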